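/- Let $G$ be a finitely generated group. Let $\mathcal B(G)$ be the Boolean algebra of all subsets $A\subseteq G$ such that, for every $g\in G$, the symmetric difference of $Ag$ and $A$ is finite; $G$ acts on it by left translation. Let $\mathcal F\subseteq\mathcal B(G)$ be a $G$-stable subset consisting of finitely many $G$-orbits. A $G$-tree is a (nonempty) tree with oriented edges on which $G$ acts by orientation-preserving graph automorphisms. Then there exists a $G$-tree $T$, with finitely many $G$-orbits of vertices and of edges, such that the $G$-stabilizer of each edge of $T$ is finite and, for every subgroup $H\le G$, the following are equivalent: (a) $H$ stabilizes some vertex of $T$, that is, $H$ is contained in the $G$-stabilizer of some vertex of $T$; (b) for each $A\in\mathcal F$ there exists a subset $B\subseteq G$ with $BH=B$ such that the symmetric difference of $A$ and $B$ is finite. -/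

import Mathlib

open scoped Pointwise

universe u

namespace AlmostStability

/-! ### `G`-sets -/

/-- The set of orbits `G \ W = {G w ∣ w ∈ W}` of a subset `W` of a `G`-set is finite.
It is applied to `G`-stable subsets `W`. -/
def IsGFinite (G : Type*) [Group G] {X : Type*} [MulAction G X] (W : Set X) : Prop :=
  (MulAction.orbit G '' W).Finite

/-- `W` is a `G`-stable subset (a `G`-subset) of the `G`-set `X`. -/
def IsGStable (G : Type*) [Group G] {X : Type*} [MulAction G X] (W : Set X) : Prop :=
  ∀ g : G, ∀ w ∈ W, g • w ∈ W

/-- Each element of the `G`-set `X` has finite stabilizer. -/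
def IsGQuasifree (G : Type*) [Group G] (X : Type*) [MulAction G X] : Prop :=
  ∀ x : X, Finite (MulAction.stabilizer G x)

/-- The `G`-substabilizers for the `G`-set `X`: the subgroups that stabilize some element of `X`. -/
def gSubstabs (G : Type*) [Group G] (X : Type*) [MulAction G X] : Set (Subgroup G) :=
  {H | ∃ x : X, ∀ h ∈ H, h • x = x}

/-! ### Almost stable subsets of a group -/

/-- Two subsets are almost equal if their symmetric difference is finite. -/
def AlmostEq {X : Type*} (A B : Set X) : Prop :=
  (symmDiff A B).Finite

/-- The right translate `A g = {a g ∣ a ∈ A}`. -/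
def rightTranslate {G : Type*} [Group G] (A : Set G) (g : G) : Set G :=
  (fun a => a * g) '' A

/-- `A` is almost right `G`-stable: `A g` is almost equal to `A` for each `g`. -/
def IsAlmostRightStable {G : Type*} [Group G] (A : Set G) : Prop :=
  ∀ g : G, AlmostEq (rightTranslate A g) A

theorem mem_rightTranslate {G : Type*} [Group G] {A : Set G} {g x : G} :
    x ∈ rightTranslate A g ↔ x * g⁻¹ ∈ A := by
  constructor
  · rintro ⟨a, ha, rfl⟩
    simpa using ha
  · intro h
    exact ⟨x * g⁻¹, h, by simp⟩

/-- The Boolean algebra `𝓑(G)` of the almost right `G`-stable subsets of `G`. -/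
def boolAlg (G : Type*) [Group G] : BooleanSubalgebra (Set G) where
  carrier := {A | IsAlmostRightStable A}
  supClosed' := by
    intro A hA B hB g
    refine ((hA g).union (hB g)).subset ?_
    intro x
    simp only [Set.mem_symmDiff, Set.mem_union, mem_rightTranslate, Set.sup_eq_union]
    tauto
  infClosed' := by
    intro A hA B hB g
    refine ((hA g).union (hB g)).subset ?_
    intro x
    simp only [Set.mem_symmDiff, Set.mem_union, Set.mem_inter_iff, mem_rightTranslate,
      Set.inf_eq_inter]
    tauto
  compl_mem' := by
    intro A hA g
    refine (hA g).subset ?_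
    intro x
    simp only [Set.mem_symmDiff, Set.mem_compl_iff, mem_rightTranslate]
    tauto
  bot_mem' := by
    intro g
    simp [AlmostEq, rightTranslate]

/-- `B` is a right `H`-subset of `G`. -/
def IsRightSubset {G : Type*} [Group G] (H : Subgroup G) (B : Set G) : Prop :=
  ∀ b ∈ B, ∀ h ∈ H, b * h ∈ B

/-- `A` is almost a right `H`-set: it is almost equal to some right `H`-subset of `G`. -/
def IsAlmostRightSet {G : Type*} [Group G] (H : Subgroup G) (A : Set G) : Prop :=
  ∃ B : Set G, IsRightSubset H B ∧ AlmostEq A B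

/-- The set of all subgroups `H` of `G` such that each element of `F` is almost a right `H`-set. -/
def almostStabs {G : Type*} [Group G] (F : Set (Set G)) : Set (Subgroup G) :=
  {H | ∀ A ∈ F, IsAlmostRightSet H A}

/-! ### `G`-graphs and `G`-trees -/

/-- A `G`-graph: a vertex `G`-set, an edge `G`-set, and two incidence maps, which are `G`-maps.
Loops and multiple edges are allowed. -/
structure GGraph (G : Type u) [Group G] where
  /-- The vertices. -/
  V : Type u
  /-- The edges. -/
  E : Type u
  [actV : MulAction G V]
  [actE : MulAction G E]
  /-- The initial vertex of an edge. -/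
  ι : E → V
  /-- The terminal vertex of an edge. -/
  τ : E → V
  ι_smul : ∀ (g : G) (e : E), ι (g • e) = g • ι e
  τ_smul : ∀ (g : G) (e : E), τ (g • e) = g • τ e

attribute [instance] GGraph.actV GGraph.actE

namespace GGraph

variable {G : Type u} [Group G] (X : GGraph G)

/-- The initial vertex of an element of `E^{±1} = E ⊕ E`; here `Sum.inl e` is the edge `e`,
`Sum.inr e` is its formal inverse `e⁻¹`, and inversion is `Sum.swap`. -/
def init : X.E ⊕ X.E → X.V :=
  Sum.elim X.ι X.τ

/-- The terminal vertex of an element of `E^{±1}`. -/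
def term : X.E ⊕ X.E → X.V :=
  Sum.elim X.τ X.ι

/-- `X.IsPath v p w`: the sequence `p` of elements of `E^{±1}` is the edge sequence of a path that
joins `v` to `w`. Such a path is determined by `v` and `p`. -/
def IsPath : X.V → List (X.E ⊕ X.E) → X.V → Prop
  | v, [], w => v = w
  | v, e :: p, w => X.init e = v ∧ IsPath (X.term e) p w

/-- No entry of the edge sequence is the inverse of its predecessor. -/
def IsReduced (p : List (X.E ⊕ X.E)) : Prop :=
  p.IsChain (fun e e' => e' ≠ e.swap)

/-- `X` is a tree: any two vertices are joined by a unique reduced path, and there is a vertex. -/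
def IsTree : Prop :=
  Nonempty X.V ∧ ∀ v w : X.V, ∃! p : List (X.E ⊕ X.E), X.IsPath v p w ∧ X.IsReduced p

/-- `X` is `G`-finite: the quotient graph `G \ X` has finitely many vertices and edges. -/
def GFinite : Prop :=
  IsGFinite G (Set.univ : Set X.V) ∧ IsGFinite G (Set.univ : Set X.E)

end GGraph

end AlmostStability

namespace AlmostStability

/-! ### Boundaries of subsets of a group -/

section Boundary

variable {G : Type*} [Group G]

/-! The plan is to replace `F` by a nested family `E` generating the same Boolean algebra, and to
read the tree off `E`. Almost right `H`-sets form a Boolean algebra (`almostRightAlg`), so `E` and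
`F` have the same `almostStabs`.

To obtain `E`, sets are measured by `bdryMeasure`, the sum over all `x` of `w x` times the size of
the symmetric difference of `A` and `A x`. It is invariant under left translation and
complementation. Since every `x` has positive weight, it is strictly submodular on sets neither of
which contains the other (`IsWeight.inter_add_union_lt`); a sum over generators alone would only be
submodular. A compactness argument makes the measure well-founded (`IsWeight.wellFounded`), so the
elements not generated by elements of smaller measure generate everything. Strict submodularity
makes any two of these irreducibles nested. Finitely many orbits of them suffice
(`exists_isNestedFamily`).

Vertices of the tree are consistent choices of sides, finitely different from the sides containing
`1`. Subdividing turns an element that exchanges `C` and `Cᶜ` into one fixing a midpoint. If `H`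
fixes a vertex `v`, then `C` is almost equal to the set of `g` with `g⁻¹ • C ∈ v`, which is a right
`H`-set. Conversely, if all members of `E` are almost right `H`-sets, the number of members
separating two elements of `H` is bounded. This is a bounded orbit, and comparing the depths of `C`
and `Cᶜ` defines a centre fixed by `H` (`isVertex_center`, `smul_center`). -/

/-- The symmetric difference of `A` and its right translate `A x`. -/
def bdry (A : Set G) (x : G) : Set G :=
  {y | ¬(y ∈ A ↔ y * x⁻¹ ∈ A)}

theorem mem_bdry {A : Set G} {x y : G} : y ∈ bdry A x ↔ ¬(y ∈ A ↔ y * x⁻¹ ∈ A) :=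
  Iff.rfl

theorem mem_boolAlg_iff {A : Set G} : A ∈ boolAlg G ↔ ∀ x, (bdry A x).Finite := by
  have key : ∀ x, symmDiff (rightTranslate A x) A = bdry A x := by
    intro x
    ext y
    simp only [Set.mem_symmDiff, mem_rightTranslate, mem_bdry]
    tauto
  change (∀ x, (symmDiff (rightTranslate A x) A).Finite) ↔ _
  simp only [key]

theorem bdry_one (A : Set G) : bdry A 1 = ∅ := by
  ext y
  simp [mem_bdry]

theorem bdry_mul_subset (A : Set G) (x y : G) :
    bdry A (x * y) ⊆ bdry A y ∪ (fun z => z * y) '' bdry A x := by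
  intro z hz
  by_cases h : z ∈ bdry A y
  · exact Or.inl h
  · refine Or.inr ⟨z * y⁻¹, ?_, by simp⟩
    simp only [mem_bdry, mul_inv_rev, ← mul_assoc] at hz h ⊢
    tauto

theorem bdry_inv (A : Set G) (x : G) : bdry A x⁻¹ = (fun z => z * x⁻¹) '' bdry A x := by
  ext y
  constructor
  · intro hy
    refine ⟨y * x, ?_, by simp⟩
    simp only [mem_bdry, inv_inv, mul_inv_cancel_right] at hy ⊢
    tauto
  · rintro ⟨z, hz, rfl⟩
    simp only [mem_bdry, inv_inv, inv_mul_cancel_right] at hz ⊢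
    tauto

theorem bdry_smul (g : G) (A : Set G) (x : G) : bdry (g • A) x = g • bdry A x := by
  ext y
  simp only [mem_bdry, Set.mem_smul_set_iff_inv_smul_mem, smul_eq_mul, mul_assoc]

theorem bdry_compl (A : Set G) (x : G) : bdry Aᶜ x = bdry A x := by
  ext y
  simp only [mem_bdry, Set.mem_compl_iff]
  tauto

theorem bdry_symmDiff (A B : Set G) (x : G) :
    bdry (symmDiff A B) x = symmDiff (bdry A x) (bdry B x) := by
  ext y
  simp only [mem_bdry, Set.mem_symmDiff]
  tauto

theorem smul_mem_boolAlg {A : Set G} (hA : A ∈ boolAlg G) (g : G) : g • A ∈ boolAlg G := by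
  rw [mem_boolAlg_iff] at hA ⊢
  intro x
  rw [bdry_smul]
  exact (hA x).smul_set

theorem symmDiff_mem_boolAlg {A B : Set G} (hA : A ∈ boolAlg G) (hB : B ∈ boolAlg G) :
    symmDiff A B ∈ boolAlg G := by
  rw [mem_boolAlg_iff] at hA hB ⊢
  intro x
  rw [bdry_symmDiff]
  exact ((hA x).union (hB x)).subset symmDiff_le_sup

/-- The size of the boundary of `A` in the Cayley graph with respect to `S`. -/
noncomputable def cayleyBdry (S : Finset G) (A : Set G) : ℕ :=
  ∑ s ∈ S, (bdry A s).ncard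

theorem mem_boolAlg_of_generators {S : Finset G} (hS : Subgroup.closure (S : Set G) = ⊤)
    {A : Set G} (hA : ∀ s ∈ S, (bdry A s).Finite) : A ∈ boolAlg G := by
  rw [mem_boolAlg_iff]
  intro x
  have hx : x ∈ Subgroup.closure (S : Set G) := by rw [hS]; trivial
  induction hx using Subgroup.closure_induction with
  | mem x hx => exact hA x hx
  | one => rw [bdry_one]; exact Set.finite_empty
  | mul x y _ _ hx hy => exact (hy.union (hx.image _)).subset (bdry_mul_subset A x y)
  | inv x _ hx => rw [bdry_inv]; exact hx.image _

/-- Induction on an expression of `x` in the generators. That `k` does not depend on `A` is what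
allows one weight to serve all sets. -/
theorem exists_ncard_bdry_le {S : Finset G} (hS : Subgroup.closure (S : Set G) = ⊤) (x : G) :
    ∃ k : ℕ, ∀ A ∈ boolAlg G, (bdry A x).ncard ≤ k * cayleyBdry S A := by
  have hx : x ∈ Subgroup.closure (S : Set G) := by rw [hS]; trivial
  induction hx using Subgroup.closure_induction with
  | mem x hx =>
    refine ⟨1, fun A _ => ?_⟩
    rw [one_mul]
    exact Finset.single_le_sum (f := fun s => (bdry A s).ncard) (fun _ _ => Nat.zero_le _) hx
  | one => exact ⟨0, fun A _ => by simp [bdry_one]⟩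
  | mul x y _ _ hx hy =>
    obtain ⟨k, hk⟩ := hx
    obtain ⟨l, hl⟩ := hy
    refine ⟨l + k, fun A hA => ?_⟩
    have hA' := mem_boolAlg_iff.1 hA
    calc (bdry A (x * y)).ncard
        ≤ (bdry A y ∪ (fun z => z * y) '' bdry A x).ncard :=
          Set.ncard_le_ncard (bdry_mul_subset A x y) ((hA' y).union ((hA' x).image _))
      _ ≤ (bdry A y).ncard + ((fun z => z * y) '' bdry A x).ncard := Set.ncard_union_le _ _
      _ = (bdry A y).ncard + (bdry A x).ncard := by
          rw [Set.ncard_image_of_injective _ (mul_left_injective y)]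
      _ ≤ l * cayleyBdry S A + k * cayleyBdry S A := add_le_add (hl A hA) (hk A hA)
      _ = (l + k) * cayleyBdry S A := by ring
  | inv x _ hx =>
    obtain ⟨k, hk⟩ := hx
    refine ⟨k, fun A hA => ?_⟩
    rw [bdry_inv, Set.ncard_image_of_injective _ (mul_left_injective x⁻¹)]
    exact hk A hA

/-- Both the union and the intersection of the two boundaries on the left lie in the corresponding
set on the right; inclusion-exclusion then compares the sums. -/
theorem ncard_bdry_inter_add_union_le {A B : Set G} (hA : A ∈ boolAlg G) (hB : B ∈ boolAlg G)
    (x : G) : (bdry (A ∩ B) x).ncard + (bdry (A ∪ B) x).ncard ≤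
      (bdry A x).ncard + (bdry B x).ncard := by
  have hA := mem_boolAlg_iff.1 hA x
  have hB := mem_boolAlg_iff.1 hB x
  have hsub : bdry (A ∩ B) x ∪ bdry (A ∪ B) x ⊆ bdry A x ∪ bdry B x := by
    intro y
    simp only [mem_bdry, Set.mem_union, Set.mem_inter_iff]
    tauto
  have hsub' : bdry (A ∩ B) x ∩ bdry (A ∪ B) x ⊆ bdry A x ∩ bdry B x := by
    intro y
    simp only [mem_bdry, Set.mem_union, Set.mem_inter_iff]
    tauto
  have hfin := (hA.union hB).subset hsub
  rw [← Set.ncard_union_add_ncard_inter _ _ (hfin.subset Set.subset_union_left)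
    (hfin.subset Set.subset_union_right), ← Set.ncard_union_add_ncard_inter _ _ hA hB]
  exact add_le_add (Set.ncard_le_ncard hsub (hA.union hB))
    (Set.ncard_le_ncard hsub' (hA.inter_of_left _))

/-- For `x = b⁻¹ * a` the point `a` is compared with `a * x⁻¹ = b`. Both `A` and `B` separate these
points, while `A ∩ B` contains neither and `A ∪ B` contains both. So `a` is lost from the union of
boundaries. -/
theorem ncard_bdry_inter_add_union_lt {A B : Set G} (hA : A ∈ boolAlg G) (hB : B ∈ boolAlg G)
    {a b : G} (ha : a ∈ A \ B) (hb : b ∈ B \ A) :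
    (bdry (A ∩ B) (b⁻¹ * a)).ncard + (bdry (A ∪ B) (b⁻¹ * a)).ncard <
      (bdry A (b⁻¹ * a)).ncard + (bdry B (b⁻¹ * a)).ncard := by
  have hA := mem_boolAlg_iff.1 hA (b⁻¹ * a)
  have hB := mem_boolAlg_iff.1 hB (b⁻¹ * a)
  have hsub : bdry (A ∩ B) (b⁻¹ * a) ∪ bdry (A ∪ B) (b⁻¹ * a) ⊂
      bdry A (b⁻¹ * a) ∪ bdry B (b⁻¹ * a) := by
    refine Set.ssubset_iff_subset_ne.2 ⟨?_, fun h => ?_⟩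
    · intro y
      simp only [mem_bdry, Set.mem_union, Set.mem_inter_iff]
      tauto
    · have h1 : a ∈ bdry A (b⁻¹ * a) ∪ bdry B (b⁻¹ * a) := by
        left
        simp only [mem_bdry, mul_inv_rev, inv_inv, mul_inv_cancel_left]
        have := ha.1
        have := hb.2
        tauto
      rw [← h] at h1
      obtain ⟨h1, h2⟩ := ha
      obtain ⟨h3, h4⟩ := hb
      simp only [mem_bdry, Set.mem_union, Set.mem_inter_iff, mul_inv_rev, inv_inv,
        mul_inv_cancel_left] at *
      tauto
  have hsub' : bdry (A ∩ B) (b⁻¹ * a) ∩ bdry (A ∪ B) (b⁻¹ * a) ⊆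
      bdry A (b⁻¹ * a) ∩ bdry B (b⁻¹ * a) := by
    intro y
    simp only [mem_bdry, Set.mem_union, Set.mem_inter_iff]
    tauto
  have hfin := (hA.union hB).subset hsub.1
  rw [← Set.ncard_union_add_ncard_inter _ _ (hfin.subset Set.subset_union_left)
    (hfin.subset Set.subset_union_right), ← Set.ncard_union_add_ncard_inter _ _ hA hB]
  exact add_lt_add_of_lt_of_le (Set.ncard_lt_ncard hsub (hA.union hB))
    (Set.ncard_le_ncard hsub' (hA.inter_of_left _))

end Boundary

/-! ### Weighted boundary measures -/

section Weight

variable {G : Type*} [Group G]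

/-- A positive weight on `G` for which all almost right stable sets have summable boundary. -/
structure IsWeight (w : G → ℝ) : Prop where
  pos : ∀ x, 0 < w x
  summable : ∀ A ∈ boolAlg G, Summable fun x => w x * (bdry A x).ncard

/-- The weighted size of the boundary of `A`. -/
noncomputable def bdryMeasure (w : G → ℝ) (A : Set G) : ℝ :=
  ∑' x, w x * (bdry A x).ncard

theorem countable_of_fg (hG : Group.FG G) : Countable G := by
  obtain ⟨n, _, f, hf⟩ := Group.fg_iff_exists_freeGroup_hom_surjective_finite.1 hG
  exact hf.countable

theorem exists_isWeight (hG : Group.FG G) : ∃ w : G → ℝ, IsWeight w := by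
  have := countable_of_fg hG
  obtain ⟨S, hS⟩ := hG.out
  choose l hl using exists_ncard_bdry_le hS
  obtain ⟨e, he, c, hc, -⟩ := NNReal.exists_pos_sum_of_countable one_ne_zero G
  have hl' : ∀ x, (0 : ℝ) < l x + 1 := fun x => by positivity
  -- A summable positive `e` is damped by the factor `l x` of `exists_ncard_bdry_le`; the `+ 1`
  -- keeps the denominator positive when `l x = 0`.
  refine ⟨fun x => e x / (l x + 1), fun x => div_pos (he x) (hl' x), fun A hA => ?_⟩
  have hs : Summable fun x => (e x : ℝ) * cayleyBdry S A :=
    (NNReal.summable_coe.2 hc.summable).mul_right _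
  refine Summable.of_nonneg_of_le (fun x => ?_) (fun x => ?_) hs
  · have := hl' x
    positivity
  · rw [div_mul_eq_mul_div, div_le_iff₀ (hl' x), mul_assoc]
    refine mul_le_mul_of_nonneg_left ?_ (e x).2
    have : ((bdry A x).ncard : ℝ) ≤ l x * cayleyBdry S A := by exact_mod_cast hl x A hA
    nlinarith [(Nat.cast_nonneg (cayleyBdry S A) : (0 : ℝ) ≤ _)]

variable {w : G → ℝ}

theorem bdryMeasure_smul (g : G) (A : Set G) : bdryMeasure w (g • A) = bdryMeasure w A := by
  simp only [bdryMeasure, bdry_smul, Set.ncard_smul_set]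

theorem bdryMeasure_compl (A : Set G) : bdryMeasure w Aᶜ = bdryMeasure w A := by
  simp only [bdryMeasure, bdry_compl]

theorem IsWeight.nonneg (hw : IsWeight w) (A : Set G) : 0 ≤ bdryMeasure w A :=
  tsum_nonneg fun x => mul_nonneg (hw.pos x).le (Nat.cast_nonneg _)

theorem IsWeight.inter_add_union_lt (hw : IsWeight w) {A B : Set G} (hA : A ∈ boolAlg G)
    (hB : B ∈ boolAlg G) (hAB : (A \ B).Nonempty) (hBA : (B \ A).Nonempty) :
    bdryMeasure w (A ∩ B) + bdryMeasure w (A ∪ B) < bdryMeasure w A + bdryMeasure w B := by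
  obtain ⟨a, ha⟩ := hAB
  obtain ⟨b, hb⟩ := hBA
  have h1 := hw.summable (A ∩ B) ((boolAlg G).infClosed hA hB)
  have h2 := hw.summable (A ∪ B) ((boolAlg G).supClosed hA hB)
  have h3 := hw.summable A hA
  have h4 := hw.summable B hB
  unfold bdryMeasure
  rw [← h1.tsum_add h2, ← h3.tsum_add h4]
  refine Summable.tsum_lt_tsum (i := b⁻¹ * a) (fun x => ?_) ?_ (h1.add h2) (h3.add h4)
  · rw [← mul_add, ← mul_add]
    refine mul_le_mul_of_nonneg_left ?_ (hw.pos x).le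
    exact_mod_cast ncard_bdry_inter_add_union_le hA hB x
  · rw [← mul_add, ← mul_add]
    refine mul_lt_mul_of_pos_left ?_ (hw.pos _)
    exact_mod_cast ncard_bdry_inter_add_union_lt hA hB ha hb

end Weight

/-! ### Well-foundedness of the boundary measure -/

section WellFounded

open Filter Topology

/-- The pointwise limit of a sequence of sets along an ultrafilter. -/
def ultraLimit {X : Type*} (𝒰 : Ultrafilter ℕ) (A : ℕ → Set X) : Set X :=
  {x | ∀ᶠ j in 𝒰, x ∈ A j}

theorem eventually_mem_ultraLimit_iff {X : Type*} (𝒰 : Ultrafilter ℕ) (A : ℕ → Set X) (x : X) :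
    ∀ᶠ j in 𝒰, (x ∈ ultraLimit 𝒰 A ↔ x ∈ A j) := by
  rcases 𝒰.em (fun j => x ∈ A j) with h | h
  · have hx : x ∈ ultraLimit 𝒰 A := h
    filter_upwards [h] with j hj
    exact ⟨fun _ => hj, fun _ => hx⟩
  · have hx : x ∉ ultraLimit 𝒰 A := Ultrafilter.eventually_not.1 h
    filter_upwards [h] with j hj
    exact ⟨fun h => absurd h hx, fun h => absurd h hj⟩

variable {G : Type*} [Group G]

theorem eventually_mem_bdry_ultraLimit_iff (𝒰 : Ultrafilter ℕ) (A : ℕ → Set G) (x y : G) :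
    ∀ᶠ j in 𝒰, (y ∈ bdry (ultraLimit 𝒰 A) x ↔ y ∈ bdry (A j) x) := by
  filter_upwards [eventually_mem_ultraLimit_iff 𝒰 A y,
    eventually_mem_ultraLimit_iff 𝒰 A (y * x⁻¹)] with j h1 h2
  rw [mem_bdry, mem_bdry, h1, h2]

theorem eventually_subset_bdry (𝒰 : Ultrafilter ℕ) (A : ℕ → Set G) (x : G) {K : Set G}
    (hK : K.Finite) (hKC : K ⊆ bdry (ultraLimit 𝒰 A) x) : ∀ᶠ j in 𝒰, K ⊆ bdry (A j) x := by
  have := (hK.eventually_all (l := (𝒰 : Filter ℕ))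
    (p := fun y j => y ∈ bdry (ultraLimit 𝒰 A) x ↔ y ∈ bdry (A j) x)).2
    fun y _ => eventually_mem_bdry_ultraLimit_iff 𝒰 A x y
  filter_upwards [this] with j hj y hy
  exact (hj y hy).1 (hKC hy)

theorem ncard_bdry_le_cayleyBdry {S : Finset G} {s : G} (hs : s ∈ S) (A : Set G) :
    (bdry A s).ncard ≤ cayleyBdry S A :=
  Finset.single_le_sum (f := fun s => (bdry A s).ncard) (fun _ _ => Nat.zero_le _) hs

/-- Any `n + 1` boundary points of the limit would be boundary points of some `A j` with Cayley
boundary at most `n`. -/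
theorem ultraLimit_mem_boolAlg {S : Finset G} (hS : Subgroup.closure (S : Set G) = ⊤)
    (𝒰 : Ultrafilter ℕ) {A : ℕ → Set G} (hA : ∀ j, A j ∈ boolAlg G) {n : ℕ}
    (hn : ∀ᶠ j in 𝒰, cayleyBdry S (A j) ≤ n) : ultraLimit 𝒰 A ∈ boolAlg G := by
  refine mem_boolAlg_of_generators hS fun s hs => ?_
  by_contra hinf
  obtain ⟨K, hK, hKfin, hKcard⟩ := Set.Infinite.exists_subset_ncard_eq hinf (n + 1)
  obtain ⟨j, hj, hjn⟩ := ((eventually_subset_bdry 𝒰 A s hKfin hK).and hn).exists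
  have h1 := Set.ncard_le_ncard hj (mem_boolAlg_iff.1 (hA j) s)
  have h2 := ncard_bdry_le_cayleyBdry hs (A j)
  omega

theorem eventually_bdry_ultraLimit_subset (𝒰 : Ultrafilter ℕ) {A : ℕ → Set G}
    (hC : ultraLimit 𝒰 A ∈ boolAlg G) (x : G) :
    ∀ᶠ j in 𝒰, bdry (ultraLimit 𝒰 A) x ⊆ bdry (A j) x :=
  eventually_subset_bdry 𝒰 A x (mem_boolAlg_iff.1 hC x) subset_rfl

theorem ncard_bdry_symmDiff_add_of_subset {A C : Set G} (hA : A ∈ boolAlg G) {x : G}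
    (h : bdry C x ⊆ bdry A x) :
    (bdry (symmDiff A C) x).ncard + (bdry C x).ncard = (bdry A x).ncard := by
  have : bdry (symmDiff A C) x = bdry A x \ bdry C x := by
    rw [bdry_symmDiff]
    exact symmDiff_of_ge h
  rw [this]
  exact Set.ncard_sdiff_add_ncard_of_subset h (mem_boolAlg_iff.1 hA x)

theorem ncard_bdry_symmDiff_le {A C : Set G} (hA : A ∈ boolAlg G) (hC : C ∈ boolAlg G) (x : G) :
    (bdry (symmDiff A C) x).ncard ≤ (bdry A x).ncard + (bdry C x).ncard := by
  refine (Set.ncard_le_ncard ?_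
    ((mem_boolAlg_iff.1 hA x).union (mem_boolAlg_iff.1 hC x))).trans (Set.ncard_union_le _ _)
  rw [bdry_symmDiff]
  exact symmDiff_le_sup

variable {w : G → ℝ}

theorem IsWeight.symmDiff_le (hw : IsWeight w) {A C : Set G} (hA : A ∈ boolAlg G)
    (hC : C ∈ boolAlg G) :
    bdryMeasure w (symmDiff A C) ≤ bdryMeasure w A + bdryMeasure w C := by
  have h1 := hw.summable A hA
  have h2 := hw.summable C hC
  unfold bdryMeasure
  rw [← h1.tsum_add h2]
  refine (hw.summable _ (symmDiff_mem_boolAlg hA hC)).tsum_le_tsum (fun x => ?_) (h1.add h2)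
  rw [← mul_add]
  refine mul_le_mul_of_nonneg_left ?_ (hw.pos x).le
  exact_mod_cast ncard_bdry_symmDiff_le hA hC x

/-- For fixed `x` the boundary of the limit `C` is eventually part of that of `A j`, so sizes
subtract exactly. The defect `f j x` thus vanishes eventually and is at most twice the term of `C`.
Dominated convergence applies to this combination, although the terms of the `A j` need have no
common summable bound. -/
theorem IsWeight.tendsto_symmDiff_ultraLimit (hw : IsWeight w) (𝒰 : Ultrafilter ℕ)
    {A : ℕ → Set G} (hA : ∀ j, A j ∈ boolAlg G) (hC : ultraLimit 𝒰 A ∈ boolAlg G) {L : ℝ}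
    (hL : Tendsto (fun j => bdryMeasure w (A j)) 𝒰 (𝓝 L)) :
    Tendsto (fun j => bdryMeasure w (symmDiff (A j) (ultraLimit 𝒰 A))) 𝒰
      (𝓝 (L - bdryMeasure w (ultraLimit 𝒰 A))) := by
  set C := ultraLimit 𝒰 A with hCdef
  have hD : ∀ j, symmDiff (A j) C ∈ boolAlg G := fun j => symmDiff_mem_boolAlg (hA j) hC
  let f : ℕ → G → ℝ := fun j x => w x * (bdry (symmDiff (A j) C) x).ncard +
    w x * (bdry C x).ncard - w x * (bdry (A j) x).ncard
  have hf : ∀ j, ∑' x, f j x = bdryMeasure w (symmDiff (A j) C) + bdryMeasure w C -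
      bdryMeasure w (A j) := by
    intro j
    unfold bdryMeasure
    rw [← (hw.summable _ (hD j)).tsum_add (hw.summable C hC),
      ← ((hw.summable _ (hD j)).add (hw.summable C hC)).tsum_sub (hw.summable _ (hA j))]
  have hlim : Tendsto (fun j => ∑' x, f j x) 𝒰 (𝓝 (∑' _ : G, (0 : ℝ))) := by
    refine tendsto_tsum_of_dominated_convergence (bound := fun x => w x * (bdry C x).ncard * 2)
      ((hw.summable C hC).mul_right 2) (fun x => ?_) (Eventually.of_forall fun j x => ?_)
    · refine tendsto_const_nhds.congr' ?_
      filter_upwards [eventually_bdry_ultraLimit_subset 𝒰 hC x] with j hj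
      have := ncard_bdry_symmDiff_add_of_subset (hA j) hj
      simp only [f]
      rw [← mul_add, ← mul_sub, ← this]
      push_cast
      ring
    · have h1 : ((bdry (symmDiff (A j) C) x).ncard : ℝ) ≤ (bdry (A j) x).ncard +
          (bdry C x).ncard := by exact_mod_cast ncard_bdry_symmDiff_le (hA j) hC x
      have h2 : ((bdry (A j) x).ncard : ℝ) ≤ (bdry (symmDiff (A j) C) x).ncard +
          (bdry C x).ncard := by
        have := ncard_bdry_symmDiff_le (hD j) hC x
        rw [symmDiff_symmDiff_cancel_right] at this
        exact_mod_cast this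
      simp only [f]
      rw [← mul_add, ← mul_sub, mul_assoc, Real.norm_eq_abs, abs_mul, abs_of_pos (hw.pos x)]
      refine mul_le_mul_of_nonneg_left ?_ (hw.pos x).le
      rw [abs_le]
      constructor <;> linarith
  simp only [hf, tsum_zero] at hlim
  have := (hlim.add hL).sub (tendsto_const_nhds (x := bdryMeasure w C))
  simpa using this

theorem bdryMeasure_eq_zero_of_cayleyBdry {S : Finset G}
    (hS : Subgroup.closure (S : Set G) = ⊤) {A : Set G} (hA : A ∈ boolAlg G)
    (h : cayleyBdry S A = 0) : bdryMeasure w A = 0 := by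
  have : ∀ x, (bdry A x).ncard = 0 := by
    intro x
    obtain ⟨k, hk⟩ := exists_ncard_bdry_le hS x
    simpa [h] using hk A hA
  simp [bdryMeasure, this]

theorem cayleyBdry_smul (S : Finset G) (g : G) (A : Set G) :
    cayleyBdry S (g • A) = cayleyBdry S A := by
  simp only [cayleyBdry, bdry_smul, Set.ncard_smul_set]

theorem exists_smul_one_mem_bdry {S : Finset G} (𝒰 : Ultrafilter ℕ) {A : ℕ → Set G}
    (hA : ∀ᶠ j in 𝒰, cayleyBdry S (A j) ≠ 0) :
    ∃ s ∈ S, ∃ g : ℕ → G, ∀ᶠ j in 𝒰, (1 : G) ∈ bdry (g j • A j) s := by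
  -- As `S` is finite, the ultrafilter selects one generator `s` for almost all `j`; a boundary
  -- point is then translated to `1`.
  have h : ∀ᶠ j in 𝒰, ∃ s ∈ (S : Set G), (bdry (A j) s).Nonempty := by
    filter_upwards [hA] with j hj
    obtain ⟨s, hs, hne⟩ := Finset.exists_ne_zero_of_sum_ne_zero hj
    exact ⟨s, hs, Set.nonempty_of_ncard_ne_zero hne⟩
  obtain ⟨s, hs, h⟩ := (Ultrafilter.eventually_exists_mem_iff S.finite_toSet).1 h
  have h' : ∀ j, ∃ y : G, (bdry (A j) s).Nonempty → y ∈ bdry (A j) s := by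
    intro j
    by_cases hne : (bdry (A j) s).Nonempty
    · exact ⟨hne.some, fun _ => hne.some_mem⟩
    · exact ⟨1, fun h => absurd h hne⟩
  choose y hy using h'
  refine ⟨s, hs, fun j => (y j)⁻¹, ?_⟩
  filter_upwards [h] with j hj
  rw [bdry_smul, Set.mem_smul_set_iff_inv_smul_mem]
  simpa using hy j hj

/-- Induction on the bound for the Cayley boundary. After translation the ultralimit has nonempty
boundary, and taking the symmetric difference with it strictly lowers the bound while shifting the
limit by its measure. -/
theorem IsWeight.not_tendsto_from_above (hw : IsWeight w) {S : Finset G}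
    (hS : Subgroup.closure (S : Set G) = ⊤) (𝒰 : Ultrafilter ℕ) (n : ℕ) :
    ∀ (A : ℕ → Set G) (L : ℝ), (∀ j, A j ∈ boolAlg G) → (∀ᶠ j in 𝒰, cayleyBdry S (A j) ≤ n) →
      Tendsto (fun j => bdryMeasure w (A j)) 𝒰 (𝓝 L) → ¬∀ j, L < bdryMeasure w (A j) := by
  induction n with
  | zero =>
    intro A L hA hn hL hlt
    have h0 : ∀ᶠ j in 𝒰, bdryMeasure w (A j) = 0 := by
      filter_upwards [hn] with j hj
      exact bdryMeasure_eq_zero_of_cayleyBdry hS (hA j) (Nat.le_zero.1 hj)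
    have : L = 0 := tendsto_nhds_unique hL (tendsto_const_nhds.congr' (h0.mono fun _ h => h.symm))
    obtain ⟨j, hj⟩ := h0.exists
    exact (hlt j).ne (this.trans hj.symm)
  | succ n ih =>
    intro A L hA hn hL hlt
    rcases 𝒰.em (fun j => cayleyBdry S (A j) = 0) with h0 | h0
    · exact ih A L hA (h0.mono fun j hj => hj.trans_le (Nat.zero_le n)) hL hlt
    obtain ⟨s, hs, g, hg⟩ := exists_smul_one_mem_bdry 𝒰 h0
    obtain ⟨A', hgA⟩ : ∃ A' : ℕ → Set G, ∀ j, A' j = g j • A j := ⟨_, fun _ => rfl⟩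
    have hμ : ∀ j, bdryMeasure w (A' j) = bdryMeasure w (A j) := fun j => by
      rw [hgA, bdryMeasure_smul]
    have hA' : ∀ j, A' j ∈ boolAlg G := fun j => hgA j ▸ smul_mem_boolAlg (hA j) _
    have hn' : ∀ᶠ j in 𝒰, cayleyBdry S (A' j) ≤ n + 1 := by simpa only [hgA, cayleyBdry_smul]
    have hL' : Tendsto (fun j => bdryMeasure w (A' j)) 𝒰 (𝓝 L) := by simpa only [hμ]
    simp only [← hgA] at hg
    have hC := ultraLimit_mem_boolAlg hS 𝒰 hA' hn'
    have hD := fun j => symmDiff_mem_boolAlg (hA' j) hC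
    refine ih _ _ hD ?_ (hw.tendsto_symmDiff_ultraLimit 𝒰 hA' hC hL') fun j => ?_
    · have hpos : 0 < (bdry (ultraLimit 𝒰 A') s).ncard := by
        rw [Set.ncard_pos (mem_boolAlg_iff.1 hC s)]
        obtain ⟨j, hj, hj'⟩ := (hg.and (eventually_mem_bdry_ultraLimit_iff 𝒰 A' s 1)).exists
        exact ⟨1, hj'.2 hj⟩
      have hsub := (S.finite_toSet.eventually_all (l := (𝒰 : Filter ℕ))).2
        fun s _ => eventually_bdry_ultraLimit_subset 𝒰 hC s
      filter_upwards [hsub, hn'] with j hj hjn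
      have hsum : cayleyBdry S (symmDiff (A' j) (ultraLimit 𝒰 A')) +
          cayleyBdry S (ultraLimit 𝒰 A') = cayleyBdry S (A' j) := by
        unfold cayleyBdry
        rw [← Finset.sum_add_distrib]
        exact Finset.sum_congr rfl fun t ht => ncard_bdry_symmDiff_add_of_subset (hA' j) (hj t ht)
      have := ncard_bdry_le_cayleyBdry hs (ultraLimit 𝒰 A')
      omega
    -- Subadditivity keeps the new measures strictly above the new limit.
    · have h1 := hw.symmDiff_le (hD j) hC
      rw [symmDiff_symmDiff_cancel_right, hμ] at h1
      have h2 := hlt j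
      linarith

theorem IsWeight.exists_cayleyBdry_le (hw : IsWeight w) (S : Finset G) (r : ℝ) :
    ∃ n : ℕ, ∀ A ∈ boolAlg G, bdryMeasure w A ≤ r → cayleyBdry S A ≤ n := by
  refine ⟨⌈∑ s ∈ S, r / w s⌉₊, fun A hA hr => ?_⟩
  have : (cayleyBdry S A : ℝ) ≤ ∑ s ∈ S, r / w s := by
    unfold cayleyBdry
    push_cast
    refine Finset.sum_le_sum fun s _ => ?_
    rw [le_div_iff₀ (hw.pos s), mul_comm]
    exact ((hw.summable A hA).le_tsum s fun x _ =>
      mul_nonneg (hw.pos x).le (Nat.cast_nonneg _)).trans hr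
  exact_mod_cast this.trans (Nat.le_ceil _)

theorem IsWeight.wellFounded (hw : IsWeight w) (hG : Group.FG G) :
    WellFounded fun A B : boolAlg G => bdryMeasure w (A : Set G) < bdryMeasure w (B : Set G) := by
  obtain ⟨S, hS⟩ := hG.out
  rw [wellFounded_iff_isEmpty_descending_chain]
  refine ⟨fun ⟨f, hf⟩ => ?_⟩
  have hanti : StrictAnti fun n => bdryMeasure w (f n : Set G) := strictAnti_nat_of_succ_lt hf
  have hbdd : BddBelow (Set.range fun n => bdryMeasure w (f n : Set G)) :=
    ⟨0, by rintro _ ⟨n, rfl⟩; exact hw.nonneg _⟩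
  obtain ⟨n, hn⟩ := hw.exists_cayleyBdry_le S (bdryMeasure w (f 0 : Set G))
  -- A strictly decreasing sequence of measures converges to its infimum from strictly above, and
  -- bounded measure bounds the Cayley boundary.
  refine hw.not_tendsto_from_above hS (hyperfilter ℕ) n (fun j => (f j : Set G)) _
    (fun j => (f j).2)
    (Eventually.of_forall fun j => hn _ (f j).2 (hanti.antitone (Nat.zero_le j)))
    ((tendsto_atTop_ciInf hanti.antitone hbdd).mono_left Nat.hyperfilter_le_atTop) fun j => ?_
  exact (ciInf_le hbdd (j + 1)).trans_lt (hf j)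

end WellFounded

/-! ### Nested generating sets -/

section Nested

open BooleanSubalgebra

/-- One of `A`, `Aᶜ` is contained in one of `B`, `Bᶜ`. -/
def IsNestedPair {X : Type*} (A B : Set X) : Prop :=
  A ⊆ B ∨ A ⊆ Bᶜ ∨ Aᶜ ⊆ B ∨ Aᶜ ⊆ Bᶜ

theorem inter_mem_of_mem {X : Type*} {L : BooleanSubalgebra (Set X)} {A B : Set X} (hA : A ∈ L)
    (hB : B ∈ L) : A ∩ B ∈ L :=
  inf_mem hA hB

theorem mem_of_inter_mem_of_diff_mem {X : Type*} {L : BooleanSubalgebra (Set X)} {A B : Set X}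
    (h1 : A ∩ B ∈ L) (h2 : A ∩ Bᶜ ∈ L) : A ∈ L := by
  have : A ∩ B ∪ A ∩ Bᶜ ∈ L := sup_mem h1 h2
  rwa [Set.inter_union_compl] at this

theorem exists_finite_subset_mem_closure {X : Type*} {E : Set (Set X)} {A : Set X}
    (hA : A ∈ closure E) : ∃ R ⊆ E, R.Finite ∧ A ∈ closure R := by
  induction hA using closure_bot_sup_induction with
  | mem A hA => exact ⟨{A}, by simpa using hA, Set.finite_singleton A, subset_closure rfl⟩
  | bot => exact ⟨∅, Set.empty_subset _, Set.finite_empty, bot_mem⟩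
  | sup A _ B _ hA hB =>
    obtain ⟨R, hR, hRf, hAR⟩ := hA
    obtain ⟨R', hR', hRf', hBR⟩ := hB
    exact ⟨R ∪ R', Set.union_subset hR hR', hRf.union hRf',
      sup_mem (closure_mono Set.subset_union_left hAR) (closure_mono Set.subset_union_right hBR)⟩
  | compl A _ hA =>
    obtain ⟨R, hR, hRf, hAR⟩ := hA
    exact ⟨R, hR, hRf, compl_mem hAR⟩

variable {G : Type*} [Group G]

theorem IsGStable.closure {E : Set (Set G)} (hE : IsGStable G E) :
    IsGStable G (closure E : Set (Set G)) := by
  intro g A hA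
  induction hA using closure_bot_sup_induction with
  | mem A hA => exact subset_closure (hE g A hA)
  | bot => rw [Set.bot_eq_empty, Set.smul_set_empty]; exact bot_mem
  | sup A _ B _ hA hB =>
    change g • (A ∪ B) ∈ BooleanSubalgebra.closure E
    rw [Set.smul_set_union]
    exact sup_mem hA hB
  | compl A _ hA =>
    rw [Set.smul_set_compl]
    exact compl_mem hA

/-- The elements of `L` which are not generated by the elements of `L` of smaller measure. -/
def irreducibles (w : G → ℝ) (L : BooleanSubalgebra (Set G)) : Set (Set G) :=
  {A | A ∈ L ∧ A ∉ closure {B | B ∈ L ∧ bdryMeasure w B < bdryMeasure w A}}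

variable {w : G → ℝ} {L : BooleanSubalgebra (Set G)}

theorem compl_mem_irreducibles {A : Set G} (hA : A ∈ irreducibles w L) :
    Aᶜ ∈ irreducibles w L := by
  refine ⟨compl_mem hA.1, ?_⟩
  rw [bdryMeasure_compl, compl_mem_iff]
  exact hA.2

theorem empty_notMem_irreducibles : ∅ ∉ irreducibles w L :=
  fun h => h.2 bot_mem

theorem smul_mem_irreducibles (hL : IsGStable G (L : Set (Set G))) (g : G) {A : Set G}
    (hA : A ∈ irreducibles w L) : g • A ∈ irreducibles w L := by
  refine ⟨hL g A hA.1, fun h => hA.2 ?_⟩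
  rw [bdryMeasure_smul] at h
  have hst : IsGStable G {B | B ∈ L ∧ bdryMeasure w B < bdryMeasure w A} := by
    intro g B hB
    exact ⟨hL g B hB.1, by rw [bdryMeasure_smul]; exact hB.2⟩
  simpa using hst.closure g⁻¹ _ h

theorem le_closure_irreducibles (hw : IsWeight w) (hG : Group.FG G) (hL : L ≤ boolAlg G) :
    L ≤ closure (irreducibles w L) := by
  suffices h : ∀ A : boolAlg G, (A : Set G) ∈ L → (A : Set G) ∈ closure (irreducibles w L) from
    fun A hA => h ⟨A, hL hA⟩ hA
  intro A
  induction A using (hw.wellFounded hG).induction with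
  | _ A ih =>
    intro hA
    by_cases h : (A : Set G) ∈ irreducibles w L
    · exact subset_closure h
    · have h' : (A : Set G) ∈ closure {B | B ∈ L ∧ bdryMeasure w B < bdryMeasure w (A : Set G)} := by
        by_contra h'
        exact h ⟨hA, h'⟩
      refine closure_le.2 ?_ h'
      exact fun B hB => ih ⟨B, hL hB.1⟩ hB.2 hB.1

theorem IsWeight.inter_add_inter_compl_lt (hw : IsWeight w) {A B : Set G} (hA : A ∈ boolAlg G)
    (hB : B ∈ boolAlg G) (h1 : (A ∩ Bᶜ).Nonempty) (h2 : (Aᶜ ∩ B).Nonempty) :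
    bdryMeasure w (A ∩ B) + bdryMeasure w (Aᶜ ∩ Bᶜ) < bdryMeasure w A + bdryMeasure w B := by
  rw [← Set.compl_union, bdryMeasure_compl]
  refine hw.inter_add_union_lt hA hB h1 ?_
  rwa [Set.sdiff_eq, Set.inter_comm]

theorem notMem_irreducibles_of_lt {A B : Set G} (hA : A ∈ L) (hB : B ∈ L)
    (h1 : bdryMeasure w (A ∩ B) < bdryMeasure w A)
    (h2 : bdryMeasure w (A ∩ Bᶜ) < bdryMeasure w A) : A ∉ irreducibles w L := fun h =>
  h.2 (mem_of_inter_mem_of_diff_mem (subset_closure ⟨inter_mem_of_mem hA hB, h1⟩)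
    (subset_closure ⟨inter_mem_of_mem hA (compl_mem hB), h2⟩))

/-- If all four corners are nonempty, each pair of opposite corners has total measure below that of
`A` plus that of `B`. Irreducibility of `A`, `Aᶜ`, `B`, `Bᶜ` says that each is at most the larger of
its two corners. -/
theorem isNestedPair_of_irreducibles_of_le (hw : IsWeight w) (hL : L ≤ boolAlg G) {A B : Set G}
    (hA : A ∈ irreducibles w L) (hB : B ∈ irreducibles w L)
    (hle : bdryMeasure w B ≤ bdryMeasure w A) : IsNestedPair A B := by
  by_contra hcross
  simp only [IsNestedPair, not_or, Set.not_subset_iff_exists_mem_notMem] at hcross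
  obtain ⟨⟨a, ha, ha'⟩, ⟨b, hb, hb'⟩, ⟨c, hc, hc'⟩, ⟨d, hd, hd'⟩⟩ := hcross
  rw [Set.mem_compl_iff, not_not] at hb' hd'
  have hAB := hw.inter_add_inter_compl_lt (hL hA.1) (hL hB.1) ⟨a, ha, ha'⟩ ⟨d, hd, hd'⟩
  have hAB' := hw.inter_add_inter_compl_lt (hL hA.1) (compl_mem (hL hB.1))
    (by rw [compl_compl]; exact ⟨b, hb, hb'⟩) ⟨c, hc, hc'⟩
  rw [compl_compl, bdryMeasure_compl] at hAB'
  have n1 := fun h1 h2 => notMem_irreducibles_of_lt (w := w) hA.1 hB.1 h1 h2 hA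
  have n2 := fun h1 h2 => notMem_irreducibles_of_lt (w := w) (compl_mem hA.1) hB.1 h1 h2
    (compl_mem_irreducibles hA)
  have n3 := fun h1 h2 => notMem_irreducibles_of_lt (w := w) hB.1 hA.1 h1 h2 hB
  have n4 := fun h1 h2 => notMem_irreducibles_of_lt (w := w) (compl_mem hB.1) hA.1 h1 h2
    (compl_mem_irreducibles hB)
  simp only [bdryMeasure_compl] at n2 n4
  rw [Set.inter_comm B, Set.inter_comm B] at n3
  rw [Set.inter_comm Bᶜ, Set.inter_comm Bᶜ] at n4
  -- Some corner in `A` has at least the measure of `A`, so the opposite one is smaller than `B`,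
  -- hence than `A`. The other two corners must then reach the measures of `A` and `B`, against the
  -- second inequality.
  grind

theorem IsNestedPair.symm {X : Type*} {A B : Set X} (h : IsNestedPair A B) :
    IsNestedPair B A := by
  rcases h with h | h | h | h
  · exact Or.inr (Or.inr (Or.inr (Set.compl_subset_compl.2 h)))
  · exact Or.inr (Or.inl (Set.subset_compl_comm.1 h))
  · exact Or.inr (Or.inr (Or.inl (Set.compl_subset_comm.1 h)))
  · exact Or.inl (Set.compl_subset_compl.1 h)

theorem isNestedPair_of_irreducibles (hw : IsWeight w) (hL : L ≤ boolAlg G) {A B : Set G}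
    (hA : A ∈ irreducibles w L) (hB : B ∈ irreducibles w L) : IsNestedPair A B := by
  rcases le_total (bdryMeasure w B) (bdryMeasure w A) with h | h
  · exact isNestedPair_of_irreducibles_of_le hw hL hA hB h
  · exact (isNestedPair_of_irreducibles_of_le hw hL hB hA h).symm

/-- A `G`-finite, `G`-stable, nested family of proper nonempty almost right stable subsets of `G`
which is closed under complementation. -/
structure IsNestedFamily (E : Set (Set G)) : Prop where
  stable : IsGStable G E
  compl_mem : ∀ C ∈ E, Cᶜ ∈ E
  nested : ∀ C ∈ E, ∀ D ∈ E, IsNestedPair C D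
  empty_notMem : ∅ ∉ E
  subset_boolAlg : ∀ C ∈ E, C ∈ boolAlg G
  exists_finite : ∃ R ⊆ E, R.Finite ∧ ∀ C ∈ E, ∃ g : G, ∃ D ∈ R, g • D = C

theorem IsGFinite.exists_finite {X : Type*} [MulAction G X] {F : Set X} (hF : IsGFinite G F) :
    ∃ R ⊆ F, R.Finite ∧ ∀ A ∈ F, ∃ g : G, ∃ B ∈ R, g • B = A := by
  obtain ⟨R, hR, hbij⟩ := Set.exists_subset_bijOn F (MulAction.orbit G)
  refine ⟨R, hR, hbij.finite_iff_finite.2 hF, fun A hA => ?_⟩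
  obtain ⟨B, hB, hBA⟩ := hbij.surjOn ⟨A, hA, rfl⟩
  have hAB : A ∈ MulAction.orbit G B := hBA ▸ MulAction.mem_orbit_self A
  obtain ⟨g, hg⟩ := hAB
  exact ⟨g, B, hB, hg⟩

theorem exists_isNestedFamily (hG : Group.FG G) {F : Set (Set G)}
    (hFB : ∀ A ∈ F, A ∈ boolAlg G) (hFstable : IsGStable G F) (hFfinite : IsGFinite G F) :
    ∃ E, IsNestedFamily E ∧ closure E = closure F := by
  obtain ⟨w, hw⟩ := exists_isWeight hG
  have hL : closure F ≤ boolAlg G := closure_le.2 hFB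
  obtain ⟨R, hRF, hRfin, hR⟩ := hFfinite.exists_finite
  have hgen : ∀ A ∈ F, ∃ K ⊆ irreducibles w (closure F), K.Finite ∧ A ∈ closure K := fun A hA =>
    exists_finite_subset_mem_closure (le_closure_irreducibles hw hG hL (subset_closure hA))
  choose! K hKsub hKfin hKmem using hgen
  let R₀ : Set (Set G) := ⋃ A ∈ R, K A
  have hR₀fin : R₀.Finite := hRfin.biUnion fun A hA => hKfin A (hRF hA)
  have hR₀ : R₀ ⊆ irreducibles w (closure F) := Set.iUnion₂_subset fun A hA => hKsub A (hRF hA)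
  let R₁ : Set (Set G) := R₀ ∪ compl '' R₀
  have hR₁ : R₁ ⊆ irreducibles w (closure F) := by
    refine Set.union_subset hR₀ ?_
    rintro _ ⟨C, hC, rfl⟩
    exact compl_mem_irreducibles (hR₀ hC)
  let E : Set (Set G) := {C | ∃ g : G, ∃ D ∈ R₁, g • D = C}
  have hE : E ⊆ irreducibles w (closure F) := by
    rintro _ ⟨g, D, hD, rfl⟩
    exact smul_mem_irreducibles hFstable.closure g (hR₁ hD)
  have hR₁E : R₁ ⊆ E := fun D hD => ⟨1, D, hD, one_smul G D⟩
  have hEst : IsGStable G E := by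
    rintro h _ ⟨g, D, hD, rfl⟩
    exact ⟨h * g, D, hD, mul_smul h g D⟩
  refine ⟨E, ⟨hEst, ?_, fun C hC D hD => isNestedPair_of_irreducibles hw hL (hE hC) (hE hD),
    fun h => empty_notMem_irreducibles (hE h), fun C hC => hL (hE hC).1,
    R₁, hR₁E, hR₀fin.union (hR₀fin.image _), fun C hC => hC⟩, le_antisymm ?_ ?_⟩
  · rintro _ ⟨g, D, hD, rfl⟩
    refine ⟨g, Dᶜ, ?_, Set.smul_set_compl⟩
    rcases hD with hD | ⟨D, hD, rfl⟩
    · exact Or.inr ⟨D, hD, rfl⟩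
    · rw [compl_compl]
      exact Or.inl hD
  · exact closure_le.2 fun C hC => (hE hC).1
  · refine closure_le.2 fun A hA => ?_
    obtain ⟨g, B, hB, rfl⟩ := hR A hA
    refine hEst.closure g B (closure_mono ?_ (hKmem B (hRF hB)))
    exact fun C hC => hR₁E (Or.inl (Set.mem_biUnion hB hC))

end Nested

/-! ### A criterion for a graph to be a tree -/

namespace GGraph

variable {G : Type u} [Group G] {X : GGraph G}

/-- The underlying edge of an element of `E^{±1}`. -/
def label (e : X.E ⊕ X.E) : X.E :=
  Sum.elim id id e

/-- Each edge `e` joins a vertex on the `e`-side to a vertex off the `e`-side, and these two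
vertices lie on the same sides of all the other edges. -/
structure IsSeparation (X : GGraph G) (side : X.E → X.V → Prop) : Prop where
  ι_mem : ∀ e, side e (X.ι e)
  τ_notMem : ∀ e, ¬side e (X.τ e)
  iff_of_ne : ∀ e e', e' ≠ e → (side e' (X.ι e) ↔ side e' (X.τ e))

theorem isPath_append {v w : X.V} {p q : List (X.E ⊕ X.E)} :
    X.IsPath v (p ++ q) w ↔ ∃ u, X.IsPath v p u ∧ X.IsPath u q w := by
  induction p generalizing v with
  | nil => simp [IsPath]
  | cons e p ih => simp [IsPath, ih, and_assoc]

theorem eq_swap_or_eq {e f : X.E ⊕ X.E} (h : label f = label e) : f = e ∨ f = e.swap := by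
  rcases e with e | e <;> rcases f with f | f <;> simp_all [label]

theorem init_swap (e : X.E ⊕ X.E) : X.init e.swap = X.term e := by
  cases e <;> rfl

theorem term_swap (e : X.E ⊕ X.E) : X.term e.swap = X.init e := by
  cases e <;> rfl

variable {side : X.E → X.V → Prop}

namespace IsSeparation

theorem side_label (hs : X.IsSeparation side) (e : X.E ⊕ X.E) :
    side (label e) (X.init e) ↔ ¬side (label e) (X.term e) := by
  rcases e with e | e <;> simp [label, init, term, hs.ι_mem e, hs.τ_notMem e]

theorem side_iff_of_ne (hs : X.IsSeparation side) (e : X.E ⊕ X.E) {f : X.E} (hf : f ≠ label e) :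
    side f (X.init e) ↔ side f (X.term e) := by
  rcases e with e | e
  · exact hs.iff_of_ne e f hf
  · exact (hs.iff_of_ne e f hf).symm

theorem side_iff_of_notMem (hs : X.IsSeparation side) {v w : X.V} {p : List (X.E ⊕ X.E)}
    (hp : X.IsPath v p w) {f : X.E} (hf : f ∉ p.map label) : side f v ↔ side f w := by
  induction p generalizing v with
  | nil => cases hp; rfl
  | cons e p ih =>
    obtain ⟨rfl, hp⟩ := hp
    rw [List.map_cons, List.mem_cons, not_or] at hf
    rw [hs.side_iff_of_ne e hf.1, ih hp hf.2]

/-- The first edge would be crossed exactly once, leaving the two ends of the path on different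
sides of it. -/
theorem eq_nil_of_nodup (hs : X.IsSeparation side) {v : X.V} {p : List (X.E ⊕ X.E)}
    (hp : X.IsPath v p v) (hnd : (p.map label).Nodup) : p = [] := by
  rcases p with _ | ⟨e, p⟩
  · rfl
  · obtain ⟨rfl, hp⟩ := hp
    rw [List.map_cons, List.nodup_cons] at hnd
    have h1 := hs.side_iff_of_notMem hp hnd.1
    have h2 := hs.side_label e
    tauto

/-- If the first edge recurs, the side reached forces the recurrence to be its inverse. The path in
between is closed with distinct labels, hence empty, which is a backtrack. -/
theorem nodup_of_isReduced (hs : X.IsSeparation side) {v w : X.V} {p : List (X.E ⊕ X.E)}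
    (hp : X.IsPath v p w) (hr : X.IsReduced p) : (p.map label).Nodup := by
  induction p generalizing v with
  | nil => simp
  | cons e p ih =>
    obtain ⟨rfl, hp⟩ := hp
    have hr' : X.IsReduced p := List.IsChain.tail hr
    have hnd := ih hp hr'
    rw [List.map_cons, List.nodup_cons]
    refine ⟨fun hmem => ?_, hnd⟩
    obtain ⟨f, hf, hfe⟩ := List.mem_map.1 hmem
    obtain ⟨p₁, p₂, rfl⟩ := List.append_of_mem hf
    obtain ⟨u, hp₁, rfl, -⟩ := isPath_append.1 hp
    rw [List.map_append, List.map_cons, List.nodup_append'] at hnd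
    have hnot : label e ∉ p₁.map label := fun h =>
      hnd.2.2 h (by rw [hfe]; exact List.mem_cons_self)
    have h1 := hs.side_iff_of_notMem hp₁ hnot
    have h2 := hs.side_label e
    rcases eq_swap_or_eq hfe with rfl | rfl
    · tauto
    · rw [init_swap] at hp₁
      have := hs.eq_nil_of_nodup hp₁ hnd.1
      subst this
      rw [List.nil_append] at hr
      have := (List.isChain_cons_cons.1 hr).1
      exact this rfl

/-- The first edge of `p` separates `v` from `w`, so `q` crosses it, in the same direction. What
precedes it in `q` is closed with distinct labels, hence empty. -/
theorem eq_of_isReduced (hs : X.IsSeparation side) {v w : X.V} {p q : List (X.E ⊕ X.E)}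
    (hp : X.IsPath v p w) (hpr : X.IsReduced p) (hq : X.IsPath v q w) (hqr : X.IsReduced q) :
    p = q := by
  induction p generalizing v q with
  | nil =>
    cases hp
    exact (hs.eq_nil_of_nodup hq (hs.nodup_of_isReduced hq hqr)).symm
  | cons e p ih =>
    have hpnd := hs.nodup_of_isReduced hp hpr
    have hqnd := hs.nodup_of_isReduced hq hqr
    obtain ⟨rfl, hp⟩ := hp
    rw [List.map_cons, List.nodup_cons] at hpnd
    have h1 := hs.side_iff_of_notMem hp hpnd.1
    have h2 := hs.side_label e
    have hmem : label e ∈ q.map label := by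
      by_contra hnot
      have := hs.side_iff_of_notMem hq hnot
      tauto
    obtain ⟨f, hf, hfe⟩ := List.mem_map.1 hmem
    obtain ⟨q₁, q₂, rfl⟩ := List.append_of_mem hf
    obtain ⟨u, hq₁, rfl, hq₂⟩ := isPath_append.1 hq
    rw [List.map_append, List.map_cons, List.nodup_append'] at hqnd
    have hnot : label e ∉ q₁.map label := fun h =>
      hqnd.2.2 h (by rw [hfe]; exact List.mem_cons_self)
    have h3 := hs.side_iff_of_notMem hq₁ hnot
    rcases eq_swap_or_eq hfe with rfl | rfl
    · have := hs.eq_nil_of_nodup hq₁ hqnd.1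
      subst this
      rw [List.nil_append] at hqr ⊢
      rw [ih hp (List.IsChain.tail hpr) hq₂ (List.IsChain.tail hqr)]
    · rw [init_swap] at h3
      tauto

end IsSeparation

theorem exists_isReduced {v w : X.V} {p : List (X.E ⊕ X.E)} (hp : X.IsPath v p w) :
    ∃ q, X.IsPath v q w ∧ X.IsReduced q := by
  induction p generalizing v with
  | nil => exact ⟨[], hp, List.isChain_nil⟩
  | cons e p ih =>
    obtain ⟨rfl, hp⟩ := hp
    obtain ⟨q, hq, hqr⟩ := ih hp
    rcases q with _ | ⟨f, q⟩
    · exact ⟨[e], ⟨rfl, hq⟩, List.isChain_singleton e⟩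
    · by_cases hf : f = e.swap
      · subst hf
        refine ⟨q, ?_, List.IsChain.tail hqr⟩
        rw [← term_swap]
        exact hq.2
      · exact ⟨e :: f :: q, ⟨rfl, hq⟩, List.isChain_cons_cons.2 ⟨hf, hqr⟩⟩

theorem IsSeparation.isTree (hs : X.IsSeparation side) (hne : Nonempty X.V)
    (hconn : ∀ v w, ∃ p, X.IsPath v p w) : X.IsTree := by
  refine ⟨hne, fun v w => ?_⟩
  obtain ⟨p, hp⟩ := hconn v w
  obtain ⟨q, hq, hqr⟩ := exists_isReduced hp
  exact ⟨q, ⟨hq, hqr⟩, fun q' hq' => hs.eq_of_isReduced hq'.1 hq'.2 hq hqr⟩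

end GGraph

/-! ### The tree of a nested family -/

section Vertices

variable {G : Type*} [Group G] {E : Set (Set G)}

namespace IsNestedFamily

theorem nonempty_of_mem (hE : IsNestedFamily E) {C : Set G} (hC : C ∈ E) : C.Nonempty :=
  Set.nonempty_iff_ne_empty.2 fun h => hE.empty_notMem (h ▸ hC)

theorem smul_mem_iff (hE : IsNestedFamily E) (g : G) {C : Set G} : g • C ∈ E ↔ C ∈ E :=
  ⟨fun h => by simpa using hE.stable g⁻¹ _ h, hE.stable g C⟩

/-- If `g • D` separates `a` from `b`, then `y = g⁻¹ * a` is a boundary point of `D`, and it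
determines `g = a * y⁻¹`. -/
theorem separating_subset {R : Set (Set G)} (hR : ∀ C ∈ E, ∃ g : G, ∃ D ∈ R, g • D = C)
    (a b : G) : {C | C ∈ E ∧ a ∈ C ∧ b ∉ C} ⊆
      ⋃ D ∈ R, (fun y : G => (a * y⁻¹) • D) '' bdry D (b⁻¹ * a) := by
  rintro C ⟨hC, ha, hb⟩
  obtain ⟨g, D, hD, rfl⟩ := hR C hC
  rw [Set.mem_smul_set_iff_inv_smul_mem, smul_eq_mul] at ha hb
  refine Set.mem_biUnion hD ⟨g⁻¹ * a, ?_, by simp⟩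
  have : g⁻¹ * a * (b⁻¹ * a)⁻¹ = g⁻¹ * b := by group
  rw [mem_bdry, this]
  tauto

theorem finite_separating (hE : IsNestedFamily E) (a b : G) :
    {C | C ∈ E ∧ a ∈ C ∧ b ∉ C}.Finite := by
  obtain ⟨R, hRE, hRfin, hR⟩ := hE.exists_finite
  refine (hRfin.biUnion fun D hD => Set.Finite.image _ ?_).subset (separating_subset hR a b)
  exact mem_boolAlg_iff.1 (hE.subset_boolAlg D (hRE hD)) _

/-- With `a ∈ C` and `b ∉ C`, any such `g` puts `g * a` in a fixed finite boundary of `D`.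
Finiteness of edge stabilizers is the case `C = D`. -/
theorem finite_transporter (hE : IsNestedFamily E) {C D : Set G} (hC : C ∈ E) (hD : D ∈ E) :
    {g : G | g • C = D}.Finite := by
  obtain ⟨a, ha⟩ := hE.nonempty_of_mem hC
  obtain ⟨b, hb⟩ := hE.nonempty_of_mem (hE.compl_mem C hC)
  refine ((mem_boolAlg_iff.1 (hE.subset_boolAlg D hD) (b⁻¹ * a)).image
    fun y => y * a⁻¹).subset ?_
  rintro g rfl
  refine ⟨g * a, ?_, by simp⟩
  have : g * a * (b⁻¹ * a)⁻¹ = g * b := by group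
  rw [mem_bdry, this, ← smul_eq_mul, ← smul_eq_mul, Set.smul_mem_smul_set_iff,
    Set.smul_mem_smul_set_iff]
  exact fun h => hb (h.1 ha)

end IsNestedFamily

/-- The elements of `E` which contain `g`. -/
def principal (E : Set (Set G)) (g : G) : Set (Set G) :=
  {C | C ∈ E ∧ g ∈ C}

/-- The vertices of the barycentric subdivision of the tree of a nested family: consistent choices
of a side for all pairs `C`, `Cᶜ` of elements of `E`, with the possible exception of one pair. -/
structure IsVertex (E v : Set (Set G)) : Prop where
  subset : v ⊆ E
  mem_of_subset : ∀ C ∈ v, ∀ D ∈ E, C ⊆ D → D ∈ v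
  compl_notMem : ∀ C ∈ v, Cᶜ ∉ v
  unique_gap : ∀ C ∈ E, ∀ D ∈ E, C ∉ v → Cᶜ ∉ v → D ∉ v → Dᶜ ∉ v → D = C ∨ D = Cᶜ
  finite : (symmDiff v (principal E 1)).Finite

theorem smul_principal (hE : IsNestedFamily E) (g h : G) :
    g • principal E h = principal E (g * h) := by
  ext C
  rw [Set.mem_smul_set_iff_inv_smul_mem]
  change (g⁻¹ • C ∈ E ∧ h ∈ g⁻¹ • C) ↔ (C ∈ E ∧ g * h ∈ C)
  rw [hE.smul_mem_iff, Set.mem_inv_smul_set_iff, smul_eq_mul]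

theorem finite_symmDiff_principal (hE : IsNestedFamily E) (g h : G) :
    (symmDiff (principal E g) (principal E h)).Finite := by
  refine ((hE.finite_separating g h).union (hE.finite_separating h g)).subset ?_
  rintro C (⟨⟨hC, hg⟩, hh⟩ | ⟨⟨hC, hh⟩, hg⟩)
  · exact Or.inl ⟨hC, hg, fun h => hh ⟨hC, h⟩⟩
  · exact Or.inr ⟨hC, hh, fun h => hg ⟨hC, h⟩⟩

theorem finite_symmDiff_trans {X : Type*} {A B C : Set X} (h1 : (symmDiff A B).Finite)
    (h2 : (symmDiff B C).Finite) : (symmDiff A C).Finite :=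
  (h1.union h2).subset (symmDiff_triangle A B C)

theorem isVertex_principal (hE : IsNestedFamily E) : IsVertex E (principal E 1) where
  subset := fun _ hC => hC.1
  mem_of_subset := fun _ hC _ hD hCD => ⟨hD, hCD hC.2⟩
  compl_notMem := fun _ hC hC' => hC'.2 hC.2
  unique_gap := fun C hC _ _ hCv hCv' _ _ => by
    by_cases h : (1 : G) ∈ C
    · exact absurd ⟨hC, h⟩ hCv
    · exact absurd ⟨hE.compl_mem C hC, h⟩ hCv'
  finite := by simp

theorem IsVertex.smul (hE : IsNestedFamily E) {v : Set (Set G)} (hv : IsVertex E v) (g : G) :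
    IsVertex E (g • v) where
  subset := fun C hC => by
    rw [Set.mem_smul_set_iff_inv_smul_mem] at hC
    exact (hE.smul_mem_iff _).1 (hv.subset hC)
  mem_of_subset := fun C hC D hD hCD => by
    rw [Set.mem_smul_set_iff_inv_smul_mem] at hC ⊢
    exact hv.mem_of_subset _ hC _ (hE.stable _ _ hD) (Set.smul_set_mono hCD)
  compl_notMem := fun C hC => by
    rw [Set.mem_smul_set_iff_inv_smul_mem] at hC ⊢
    rw [Set.smul_set_compl]
    exact hv.compl_notMem _ hC
  unique_gap := fun C hC D hD => by
    simp only [Set.mem_smul_set_iff_inv_smul_mem, Set.smul_set_compl]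
    intro h1 h2 h3 h4
    have := hv.unique_gap _ (hE.stable g⁻¹ _ hC) _ (hE.stable g⁻¹ _ hD) h1 h2 h3 h4
    rwa [← Set.smul_set_compl, smul_left_cancel_iff, smul_left_cancel_iff] at this
  finite := by
    refine finite_symmDiff_trans (B := g • principal E 1) ?_ ?_
    · rw [← Set.smul_set_symmDiff]
      exact hv.finite.smul_set
    · rw [smul_principal hE]
      exact finite_symmDiff_principal hE _ _

/-- The midpoint of the edge `C`. -/
def midpoint {X : Type*} (E : Set (Set X)) (C : Set X) : Set (Set X) :=
  {D | D ∈ E ∧ (C ⊂ D ∨ Cᶜ ⊂ D)}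

/-- The end of the edge `C` in which `C` is minimal. -/
def endpoint {X : Type*} (E : Set (Set X)) (C : Set X) : Set (Set X) :=
  {D | D ∈ E ∧ (C ⊆ D ∨ Cᶜ ⊂ D)}

theorem mem_endpoint_iff_of_ne {X : Type*} {E : Set (Set X)} {C D : Set X} (h : D ≠ C) :
    D ∈ endpoint E C ↔ D ∈ midpoint E C := by
  have : C ⊆ D ↔ C ⊂ D := ⟨fun h' => h'.ssubset_of_ne h.symm, fun h' => h'.subset⟩
  change (D ∈ E ∧ (C ⊆ D ∨ _)) ↔ (D ∈ E ∧ (C ⊂ D ∨ _))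
  rw [this]

theorem mem_endpoint_self {X : Type*} {E : Set (Set X)} {C : Set X} (hC : C ∈ E) :
    C ∈ endpoint E C :=
  ⟨hC, Or.inl subset_rfl⟩

theorem midpoint_compl {X : Type*} (E : Set (Set X)) (C : Set X) :
    midpoint E Cᶜ = midpoint E C := by
  ext D
  change (_ ∧ (Cᶜ ⊂ D ∨ Cᶜᶜ ⊂ D)) ↔ (_ ∧ (C ⊂ D ∨ Cᶜ ⊂ D))
  rw [compl_compl, or_comm]

theorem smul_ssubset_smul_iff (g : G) (C D : Set G) : g • C ⊂ g • D ↔ C ⊂ D := by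
  simp only [ssubset_iff_subset_not_subset, Set.smul_set_subset_smul_set_iff]

theorem smul_midpoint (hE : IsNestedFamily E) (g : G) (C : Set G) :
    g • midpoint E C = midpoint E (g • C) := by
  ext D
  rw [Set.mem_smul_set_iff_inv_smul_mem]
  change (g⁻¹ • D ∈ E ∧ (C ⊂ g⁻¹ • D ∨ Cᶜ ⊂ g⁻¹ • D)) ↔ (D ∈ E ∧ (g • C ⊂ D ∨ (g • C)ᶜ ⊂ D))
  rw [hE.smul_mem_iff, ← smul_ssubset_smul_iff g C, ← smul_ssubset_smul_iff g Cᶜ,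
    smul_inv_smul, Set.smul_set_compl]

theorem smul_endpoint (hE : IsNestedFamily E) (g : G) (C : Set G) :
    g • endpoint E C = endpoint E (g • C) := by
  ext D
  rw [Set.mem_smul_set_iff_inv_smul_mem]
  change (g⁻¹ • D ∈ E ∧ (C ⊆ g⁻¹ • D ∨ Cᶜ ⊂ g⁻¹ • D)) ↔ (D ∈ E ∧ (g • C ⊆ D ∨ (g • C)ᶜ ⊂ D))
  rw [hE.smul_mem_iff, ← Set.smul_set_subset_smul_set_iff (a := g) (A := C),
    ← smul_ssubset_smul_iff g Cᶜ, smul_inv_smul, Set.smul_set_compl]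

theorem self_notMem_midpoint (hE : IsNestedFamily E) {C : Set G} (hC : C ∈ E) :
    C ∉ midpoint E C := by
  rintro ⟨-, h | h⟩
  · exact h.ne rfl
  · obtain ⟨x, hx⟩ := hE.nonempty_of_mem (hE.compl_mem C hC)
    exact hx (h.subset hx)

theorem mem_midpoint_or (hE : IsNestedFamily E) {C D : Set G} (hC : C ∈ E) (hD : D ∈ E) :
    D ∈ midpoint E C ∨ Dᶜ ∈ midpoint E C ∨ D = C ∨ D = Cᶜ := by
  have hD' := hE.compl_mem D hD
  rcases eq_or_ne D C with h | h
  · exact Or.inr (Or.inr (Or.inl h))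
  rcases eq_or_ne D Cᶜ with h' | h'
  · exact Or.inr (Or.inr (Or.inr h'))
  rcases hE.nested C hC D hD with hn | hn | hn | hn
  · exact Or.inl ⟨hD, Or.inl (hn.ssubset_of_ne h.symm)⟩
  · exact Or.inr (Or.inl ⟨hD', Or.inl (hn.ssubset_of_ne fun h => h' (by rw [h, compl_compl]))⟩)
  · exact Or.inl ⟨hD, Or.inr (hn.ssubset_of_ne h'.symm)⟩
  · exact Or.inr (Or.inl ⟨hD', Or.inr (hn.ssubset_of_ne fun h' => h (compl_injective h').symm)⟩)

theorem mem_endpoint_or (hE : IsNestedFamily E) {C D : Set G} (hC : C ∈ E) (hD : D ∈ E) :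
    D ∈ endpoint E C ∨ Dᶜ ∈ endpoint E C := by
  have hmid : midpoint E C ⊆ endpoint E C := fun D hD => ⟨hD.1, hD.2.imp_left fun h => h.subset⟩
  rcases mem_midpoint_or hE hC hD with h | h | rfl | rfl
  · exact Or.inl (hmid h)
  · exact Or.inr (hmid h)
  · exact Or.inl (mem_endpoint_self hC)
  · rw [compl_compl]
    exact Or.inr (mem_endpoint_self hC)

theorem compl_notMem_endpoint (hE : IsNestedFamily E) {C D : Set G} (hC : C ∈ E)
    (hD : D ∈ endpoint E C) : Dᶜ ∉ endpoint E C := by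
  obtain ⟨x, hx⟩ := hE.nonempty_of_mem hC
  obtain ⟨y, hy⟩ := hE.nonempty_of_mem (hE.compl_mem C hC)
  rintro ⟨-, h'⟩
  rcases hD.2 with h | h <;> rcases h' with h' | h'
  · exact h' hx (h hx)
  · exact h'.not_subset (Set.compl_subset_compl.2 h)
  · exact h.not_subset (Set.subset_compl_comm.1 h')
  · exact h'.subset hy (h.subset hy)

theorem finite_symmDiff_endpoint (hE : IsNestedFamily E) {C : Set G} (hC : C ∈ E) :
    (symmDiff (endpoint E C) (principal E 1)).Finite := by
  obtain ⟨x, hx⟩ := hE.nonempty_of_mem hC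
  obtain ⟨y, hy⟩ := hE.nonempty_of_mem (hE.compl_mem C hC)
  have key : endpoint E C \ principal E 1 ⊆
      {D | D ∈ E ∧ x ∈ D ∧ (1 : G) ∉ D} ∪ {D | D ∈ E ∧ y ∈ D ∧ (1 : G) ∉ D} := by
    rintro D ⟨⟨hD, h⟩, h1⟩
    have h1' : (1 : G) ∉ D := fun h => h1 ⟨hD, h⟩
    rcases h with h | h
    · exact Or.inl ⟨hD, h hx, h1'⟩
    · exact Or.inr ⟨hD, h.subset hy, h1'⟩
  have hfin := ((hE.finite_separating x 1).union (hE.finite_separating y 1)).subset key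
  refine (hfin.union (hfin.image compl)).subset ?_
  rintro D (h | ⟨⟨hD, h1⟩, h⟩)
  · exact Or.inl h
  · refine Or.inr ⟨Dᶜ, ⟨(mem_endpoint_or hE hC hD).resolve_left h, fun h' => h'.2 h1⟩,
      compl_compl D⟩

theorem isVertex_endpoint (hE : IsNestedFamily E) {C : Set G} (hC : C ∈ E) :
    IsVertex E (endpoint E C) where
  subset := fun _ hD => hD.1
  mem_of_subset := fun _ hD _ hD' h =>
    ⟨hD', hD.2.imp (fun h' => h'.trans h) fun h' => h'.trans_subset h⟩
  compl_notMem := fun _ hD => compl_notMem_endpoint hE hC hD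
  unique_gap := fun _ hD _ _ h h' _ _ => ((mem_endpoint_or hE hC hD).elim h h').elim
  finite := finite_symmDiff_endpoint hE hC

theorem isVertex_midpoint (hE : IsNestedFamily E) {C : Set G} (hC : C ∈ E) :
    IsVertex E (midpoint E C) where
  subset := fun _ hD => hD.1
  mem_of_subset := fun _ hD _ hD' h =>
    ⟨hD', hD.2.imp (fun h' => h'.trans_subset h) fun h' => h'.trans_subset h⟩
  compl_notMem := fun _ hD hD' => compl_notMem_endpoint hE hC
    ⟨hD.1, hD.2.imp_left fun h => h.subset⟩ ⟨hD'.1, hD'.2.imp_left fun h => h.subset⟩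
  unique_gap := fun _ hD _ hD' h1 h2 h3 h4 => by
    have h := ((mem_midpoint_or hE hC hD).resolve_left h1).resolve_left h2
    have h' := ((mem_midpoint_or hE hC hD').resolve_left h3).resolve_left h4
    rcases h with rfl | rfl <;> rcases h' with rfl | rfl <;> simp
  finite := by
    refine finite_symmDiff_trans ?_ (finite_symmDiff_endpoint hE hC)
    refine (Set.finite_singleton C).subset fun _ hD => ?_
    by_contra hne
    have := mem_endpoint_iff_of_ne (E := E) hne
    rcases hD with ⟨h, h'⟩ | ⟨h, h'⟩
    · exact h' (this.2 h)
    · exact h' (this.1 h)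

theorem IsVertex.eq_midpoint (hE : IsNestedFamily E) {v : Set (Set G)} (hv : IsVertex E v)
    {C : Set G} (hC : C ∈ E) (h1 : C ∉ v) (h2 : Cᶜ ∉ v) : v = midpoint E C := by
  have hsub : midpoint E C ⊆ v := by
    rintro D ⟨hD, h⟩
    by_contra hDv
    by_cases hDv' : Dᶜ ∈ v
    · rcases h with h | h
      · exact h2 (hv.mem_of_subset _ hDv' _ (hE.compl_mem C hC)
          (Set.compl_subset_compl.2 h.subset))
      · exact h1 (hv.mem_of_subset _ hDv' _ hC (Set.compl_subset_comm.1 h.subset))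
    · rcases hv.unique_gap C hC D hD h1 h2 hDv hDv' with rfl | rfl
      · exact self_notMem_midpoint hE hC ⟨hC, h⟩
      · refine self_notMem_midpoint hE hD ?_
        rw [midpoint_compl]
        exact ⟨hD, h⟩
  refine Set.Subset.antisymm (fun D hD => ?_) hsub
  rcases mem_midpoint_or hE hC (hv.subset hD) with h | h | rfl | rfl
  · exact h
  · exact absurd (hsub h) (hv.compl_notMem D hD)
  · exact absurd hD h1
  · exact absurd hD h2

theorem IsVertex.eq_endpoint (hE : IsNestedFamily E) {v : Set (Set G)} (hv : IsVertex E v)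
    (hfull : ∀ D ∈ E, D ∈ v ∨ Dᶜ ∈ v) {C : Set G} (hC : C ∈ v)
    (hmin : ∀ D ∈ v, D ⊆ C → D = C) : v = endpoint E C := by
  have hCE := hv.subset hC
  have hsub : endpoint E C ⊆ v := by
    rintro D ⟨hD, h | h⟩
    · exact hv.mem_of_subset C hC D hD h
    · refine (hfull D hD).resolve_right fun h' => ?_
      have := hmin _ h' (Set.compl_subset_comm.1 h.subset)
      rw [← this, compl_compl] at h
      exact h.ne rfl
  refine Set.Subset.antisymm (fun D hD => ?_) hsub
  refine (mem_endpoint_or hE hCE (hv.subset hD)).resolve_right fun h => ?_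
  exact hv.compl_notMem D hD (hsub h)

end Vertices

/-! ### The subdivided tree: connectedness, finiteness, edge stabilizers. -/

section Tree

variable {G : Type u} [Group G] {E : Set (Set G)}

/-- The barycentric subdivision of the tree of a nested family. The edge `C` joins the vertex in
which `C` is minimal to the midpoint of the pair `C`, `Cᶜ`. -/
def nestedTree (hE : IsNestedFamily E) : GGraph G where
  V := {v : Set (Set G) // IsVertex E v}
  E := {C : Set G // C ∈ E}
  actV :=
    { smul := fun g v => ⟨g • v.1, v.2.smul hE g⟩
      one_smul := fun v => Subtype.ext (one_smul G v.1)
      mul_smul := fun g h v => Subtype.ext (mul_smul g h v.1) }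
  actE :=
    { smul := fun g C => ⟨g • C.1, hE.stable g C.1 C.2⟩
      one_smul := fun C => Subtype.ext (one_smul G C.1)
      mul_smul := fun g h C => Subtype.ext (mul_smul g h C.1) }
  ι C := ⟨endpoint E C.1, isVertex_endpoint hE C.2⟩
  τ C := ⟨midpoint E C.1, isVertex_midpoint hE C.2⟩
  ι_smul g C := Subtype.ext (smul_endpoint hE g C.1).symm
  τ_smul g C := Subtype.ext (smul_midpoint hE g C.1).symm

theorem isSeparation_nestedTree (hE : IsNestedFamily E) :
    (nestedTree hE).IsSeparation fun C v => C.1 ∈ v.1 where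
  ι_mem C := mem_endpoint_self C.2
  τ_notMem C := self_notMem_midpoint hE C.2
  iff_of_ne _ _ h := mem_endpoint_iff_of_ne fun h' => h (Subtype.ext h')

theorem ncard_symmDiff_lt {X : Type*} {A B C : Set X} {x : X} (hAC : (symmDiff A C).Finite)
    (hx : x ∈ symmDiff A C) (hx' : x ∉ symmDiff B C) (h : ∀ y, y ≠ x → (y ∈ B ↔ y ∈ A)) :
    (symmDiff B C).ncard < (symmDiff A C).ncard := by
  refine Set.ncard_lt_ncard (Set.ssubset_iff_exists.2 ⟨fun y hy => ?_, x, hx, hx'⟩) hAC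
  have hyx : y ≠ x := fun h => hx' (h ▸ hy)
  rw [Set.mem_symmDiff] at hy ⊢
  rwa [← h y hyx]

/-- The distance is the number of sides on which the vertices differ. From a midpoint, step to the
end chosen by `w`; from a full vertex, cross half of an edge minimal in `v \ w`. -/
theorem exists_step_toward (hE : IsNestedFamily E) {v w : (nestedTree hE).V} (hvw : v ≠ w) :
    ∃ e, (nestedTree hE).init e = v ∧
      (symmDiff ((nestedTree hE).term e).1 w.1).ncard < (symmDiff v.1 w.1).ncard := by
  obtain ⟨v, hv⟩ := v
  obtain ⟨w, hw⟩ := w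
  have hne : v ≠ w := fun h => hvw (Subtype.ext h)
  have hfin : (symmDiff v w).Finite :=
    finite_symmDiff_trans hv.finite (symmDiff_comm w _ ▸ hw.finite)
  by_cases hfull : ∀ D ∈ E, D ∈ v ∨ Dᶜ ∈ v
  · have hnsub : (v \ w).Nonempty := by
      rw [Set.sdiff_nonempty]
      intro hsub
      refine hne (hsub.antisymm fun D hD => (hfull D (hw.subset hD)).resolve_right fun h => ?_)
      exact hw.compl_notMem D hD (hsub h)
    have hfin' : (v \ w).Finite := hfin.subset fun D hD => Or.inl hD
    obtain ⟨C, hC⟩ := hfin'.exists_minimal hnsub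
    have hCE := hv.subset hC.prop.1
    -- Minimality in `v \ w` gives minimality in `v`: a smaller member of `v` lying in `w` would
    -- force `C ∈ w`.
    have hv' : v = endpoint E C := by
      refine hv.eq_endpoint hE hfull hC.prop.1 fun D hD hDC => hDC.antisymm ?_
      exact hC.le_of_le ⟨hD, fun h => hC.prop.2 (hw.mem_of_subset D h C hCE hDC)⟩ hDC
    refine ⟨Sum.inl ⟨C, hCE⟩, Subtype.ext hv'.symm, ?_⟩
    refine ncard_symmDiff_lt (x := C) hfin (Or.inl hC.prop) ?_ fun D hD => ?_
    · rintro (h | h)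
      · exact self_notMem_midpoint hE hCE h.1
      · exact hC.prop.2 h.1
    · change D ∈ midpoint E C ↔ D ∈ v
      rw [hv']
      exact (mem_endpoint_iff_of_ne hD).symm
  · push Not at hfull
    obtain ⟨C, hC, h1, h2⟩ := hfull
    have hstep : ∀ D ∈ E, v = midpoint E D → D ∈ w → ∃ e, (nestedTree hE).init e = ⟨v, hv⟩ ∧
        (symmDiff ((nestedTree hE).term e).1 w).ncard < (symmDiff v w).ncard := by
      intro D hD hvD hDw
      refine ⟨Sum.inr ⟨D, hD⟩, Subtype.ext hvD.symm, ?_⟩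
      refine ncard_symmDiff_lt (x := D) hfin (Or.inr ⟨hDw, ?_⟩) ?_ fun D' hD' => ?_
      · rw [hvD]
        exact self_notMem_midpoint hE hD
      · rintro (h | h)
        · exact h.2 hDw
        · exact h.2 (mem_endpoint_self hD)
      · change D' ∈ endpoint E D ↔ D' ∈ v
        rw [hvD]
        exact mem_endpoint_iff_of_ne hD'
    have hvC := hv.eq_midpoint hE hC h1 h2
    by_cases h3 : C ∈ w
    · exact hstep C hC hvC h3
    · by_cases h4 : Cᶜ ∈ w
      · exact hstep Cᶜ (hE.compl_mem C hC) (by rw [midpoint_compl, hvC]) h4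
      · exact absurd (hvC.trans (hw.eq_midpoint hE hC h3 h4).symm) hne

theorem exists_isPath_nestedTree (hE : IsNestedFamily E) (v w : (nestedTree hE).V) :
    ∃ p, (nestedTree hE).IsPath v p w := by
  induction h : (symmDiff v.1 w.1).ncard using Nat.strong_induction_on generalizing v with
  | _ n ih =>
    by_cases hvw : v = w
    · exact ⟨[], hvw⟩
    · obtain ⟨e, he, hlt⟩ := exists_step_toward hE hvw
      obtain ⟨p, hp⟩ := ih _ (h ▸ hlt) _ rfl
      exact ⟨e :: p, he, hp⟩

theorem isTree_nestedTree (hE : IsNestedFamily E) : (nestedTree hE).IsTree :=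
  (isSeparation_nestedTree hE).isTree ⟨⟨_, isVertex_principal hE⟩⟩ (exists_isPath_nestedTree hE)

theorem isGFinite_of_exists_finite {X : Type*} [MulAction G X] {W R : Set X} (hR : R.Finite)
    (h : ∀ x ∈ W, ∃ g : G, ∃ y ∈ R, g • y = x) : IsGFinite G W := by
  refine (hR.image (MulAction.orbit G)).subset ?_
  rintro _ ⟨x, hx, rfl⟩
  obtain ⟨g, y, hy, rfl⟩ := h x hx
  exact ⟨y, hy, (MulAction.orbit_smul g y).symm⟩

theorem gFinite_nestedTree (hE : IsNestedFamily E) : (nestedTree hE).GFinite := by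
  obtain ⟨R, hRE, hRfin, hR⟩ := hE.exists_finite
  let R' : Set (nestedTree hE).E := {C | C.1 ∈ R}
  have hR'fin : R'.Finite := hRfin.preimage Subtype.val_injective.injOn
  have hR' : ∀ C : (nestedTree hE).E, ∃ g : G, ∃ D ∈ R', g • D = C := by
    intro C
    obtain ⟨g, D, hD, hgD⟩ := hR C.1 C.2
    let D' : (nestedTree hE).E := ⟨D, hRE hD⟩
    exact ⟨g, D', hD, Subtype.ext hgD⟩
  refine ⟨?_, isGFinite_of_exists_finite (X := (nestedTree hE).E) hR'fin fun C _ => hR' C⟩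
  -- Every vertex other than `v₀` has a step toward it and so is an end of an edge; `v₀` is listed
  -- separately because `E` may be empty.
  let v₀ : (nestedTree hE).V := ⟨_, isVertex_principal hE⟩
  refine isGFinite_of_exists_finite (R := {v₀} ∪ ((nestedTree hE).ι '' R' ∪
    (nestedTree hE).τ '' R')) ((Set.finite_singleton _).union
    ((hR'fin.image _).union (hR'fin.image _))) fun v _ => ?_
  by_cases hv : v = v₀
  · exact ⟨1, v₀, Or.inl rfl, by rw [one_smul, hv]⟩
  · obtain ⟨e, rfl, -⟩ := exists_step_toward hE hv
    rcases e with C | C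
    · obtain ⟨g, D, hD, rfl⟩ := hR' C
      exact ⟨g, _, Or.inr (Or.inl ⟨D, hD, rfl⟩), ((nestedTree hE).ι_smul g D).symm⟩
    · obtain ⟨g, D, hD, rfl⟩ := hR' C
      exact ⟨g, _, Or.inr (Or.inr ⟨D, hD, rfl⟩), ((nestedTree hE).τ_smul g D).symm⟩

theorem isGQuasifree_nestedTree (hE : IsNestedFamily E) : IsGQuasifree G (nestedTree hE).E := by
  intro (C : (nestedTree hE).E)
  have hsub : (MulAction.stabilizer G C : Set G) ⊆ {g : G | g • C.1 = C.1} := fun g hg =>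
    congrArg Subtype.val (show g • C = C from hg)
  exact ((hE.finite_transporter C.2 C.2).subset hsub).to_subtype

end Tree

/-! ### Almost right `H`-sets -/

section AlmostRight

open BooleanSubalgebra

variable {G : Type*} [Group G]

/-- The Boolean algebra of the almost right `H`-sets. -/
def almostRightAlg (H : Subgroup G) : BooleanSubalgebra (Set G) where
  carrier := {A | IsAlmostRightSet H A}
  supClosed' := by
    rintro A ⟨A', hA', hA⟩ B ⟨B', hB', hB⟩
    refine ⟨A' ∪ B', fun b hb h hh => hb.imp (fun hb => hA' b hb h hh) fun hb => hB' b hb h hh,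
      (hA.union hB).subset ?_⟩
    intro x
    simp only [Set.mem_symmDiff, Set.mem_union, Set.sup_eq_union]
    tauto
  infClosed' := by
    rintro A ⟨A', hA', hA⟩ B ⟨B', hB', hB⟩
    refine ⟨A' ∩ B', fun b hb h hh => ⟨hA' b hb.1 h hh, hB' b hb.2 h hh⟩,
      (hA.union hB).subset ?_⟩
    intro x
    simp only [Set.mem_symmDiff, Set.mem_union, Set.mem_inter_iff, Set.inf_eq_inter]
    tauto
  compl_mem' := by
    rintro A ⟨A', hA', hA⟩
    refine ⟨A'ᶜ, fun b hb h hh hbh => hb ?_, hA.subset ?_⟩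
    · simpa using hA' _ hbh h⁻¹ (H.inv_mem hh)
    · intro x
      simp only [Set.mem_symmDiff, Set.mem_compl_iff]
      tauto
  bot_mem' := ⟨∅, fun _ hb => hb.elim, by simp [AlmostEq]⟩

theorem mem_almostStabs_iff {F : Set (Set G)} {H : Subgroup G} :
    H ∈ almostStabs F ↔ closure F ≤ almostRightAlg H := by
  rw [closure_le]
  rfl

theorem almostStabs_eq_of_closure_eq {E F : Set (Set G)} (h : closure E = closure F) :
    almostStabs E = almostStabs F := by
  ext H
  rw [mem_almostStabs_iff, mem_almostStabs_iff, h]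

/-- Since `B` is right `H`-invariant, the boundary at `h` is covered by the difference of `A` and
`B` and its translate by `h`; the bound is uniform in `h`. -/
theorem IsAlmostRightSet.exists_ncard_bdry_le {H : Subgroup G} {A : Set G}
    (hA : IsAlmostRightSet H A) : ∃ n : ℕ, ∀ h ∈ H, (bdry A h).ncard ≤ n := by
  obtain ⟨B, hB, hAB⟩ := hA
  refine ⟨(symmDiff A B).ncard + (symmDiff A B).ncard, fun h hh => ?_⟩
  have hsub : bdry A h ⊆ symmDiff A B ∪ (fun y => y * h) '' symmDiff A B := by
    intro y hy
    have hyB : y ∈ B ↔ y * h⁻¹ ∈ B :=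
      ⟨fun hb => hB y hb _ (H.inv_mem hh), fun hb => by simpa using hB _ hb h hh⟩
    by_cases hyA : y ∈ symmDiff A B
    · exact Or.inl hyA
    · refine Or.inr ⟨y * h⁻¹, ?_, by simp⟩
      rw [mem_bdry] at hy
      rw [Set.mem_symmDiff] at hyA ⊢
      tauto
  calc (bdry A h).ncard
      ≤ (symmDiff A B ∪ (fun y => y * h) '' symmDiff A B).ncard :=
        Set.ncard_le_ncard hsub (Set.Finite.union hAB (hAB.image _))
    _ ≤ (symmDiff A B).ncard + ((fun y => y * h) '' symmDiff A B).ncard := Set.ncard_union_le _ _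
    _ = _ := by rw [Set.ncard_image_of_injective _ (mul_left_injective h)]

theorem IsNestedFamily.exists_ncard_separating_le {E : Set (Set G)} (hE : IsNestedFamily E)
    {H : Subgroup G} (hH : H ∈ almostStabs E) :
    ∃ N : ℕ, ∀ a ∈ H, ∀ b ∈ H, {C | C ∈ E ∧ a ∈ C ∧ b ∉ C}.ncard ≤ N := by
  obtain ⟨R, hRE, hRfin, hR⟩ := hE.exists_finite
  have hn : ∀ D ∈ E, ∃ n : ℕ, ∀ h ∈ H, (bdry D h).ncard ≤ n := fun D hD =>
    (hH D hD).exists_ncard_bdry_le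
  choose! n hn using hn
  refine ⟨∑ D ∈ hRfin.toFinset, n D, fun a ha b hb => ?_⟩
  have hbdry : ∀ D ∈ R, (bdry D (b⁻¹ * a)).Finite := fun D hD =>
    mem_boolAlg_iff.1 (hE.subset_boolAlg D (hRE hD)) _
  have hsub := separating_subset hR a b
  calc _ ≤ _ := Set.ncard_le_ncard hsub (hRfin.biUnion fun D hD => (hbdry D hD).image _)
    _ = (⋃ D ∈ hRfin.toFinset, (fun y : G => (a * y⁻¹) • D) '' bdry D (b⁻¹ * a)).ncard := by
        simp only [Set.Finite.mem_toFinset]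
    _ ≤ ∑ D ∈ hRfin.toFinset, ((fun y : G => (a * y⁻¹) • D) '' bdry D (b⁻¹ * a)).ncard :=
        Finset.set_ncard_biUnion_le _ _
    _ ≤ _ := Finset.sum_le_sum fun D hD => by
        have hD := hRfin.mem_toFinset.1 hD
        exact (Set.ncard_image_le (hbdry D hD)).trans
          (hn D (hRE hD) _ (H.mul_mem (H.inv_mem hb) ha))

/-- The witness replaces `principal E 1` by `v` in the equivalence of `g ∈ C` with `g⁻¹ • C ∈
principal E 1`. The two vertices differ finitely, and each member of `E` arises from finitely many
`g`. -/
theorem IsVertex.isAlmostRightSet {E v : Set (Set G)} (hE : IsNestedFamily E)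
    (hv : IsVertex E v) {H : Subgroup G} (hH : ∀ h ∈ H, h • v = v) {C : Set G} (hC : C ∈ E) :
    IsAlmostRightSet H C := by
  refine ⟨{g | g⁻¹ • C ∈ v}, fun g hg h hh => ?_, ?_⟩
  · change (g * h)⁻¹ • C ∈ v
    rw [mul_inv_rev, mul_smul, ← Set.mem_smul_set_iff_inv_smul_mem, hH h hh]
    exact hg
  · have hfib : ∀ D ∈ E, {g : G | g⁻¹ • C = D}.Finite := fun D hD =>
      (hE.finite_transporter hC hD).preimage inv_injective.injOn
    have hsub : symmDiff v (principal E 1) ⊆ E := by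
      rintro D (⟨h, -⟩ | ⟨h, -⟩)
      · exact hv.subset h
      · exact h.1
    refine (hv.finite.biUnion fun D hD => hfib D (hsub hD)).subset fun g hg => ?_
    refine Set.mem_biUnion (x := g⁻¹ • C) ?_ rfl
    have hgC : g ∈ C ↔ g⁻¹ • C ∈ principal E 1 := by
      change _ ↔ (g⁻¹ • C ∈ E ∧ (1 : G) ∈ g⁻¹ • C)
      rw [hE.smul_mem_iff, Set.mem_inv_smul_set_iff, smul_eq_mul, mul_one]
      exact (and_iff_right hC).symm
    rw [Set.mem_symmDiff] at hg ⊢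
    rw [← hgC]
    exact hg.symm

end AlmostRight

/-! ### Subgroups fixing a vertex -/

section Depth

variable {G : Type*} [Group G] {E : Set (Set G)} {H : Subgroup G}

open Classical in
/-- The largest number of members of a chain of elements of `E` which meet `H` and are contained
in `C`. -/
noncomputable def depth (E : Set (Set G)) (H : Subgroup G) (C : Set G) : ℕ∞ :=
  if h : C ∈ E ∧ (C ∩ H).Nonempty then
    Order.height (⟨C, h⟩ : {C : Set G // C ∈ E ∧ (C ∩ H).Nonempty}) + 1
  else 0

theorem depth_of_nonempty {C : Set G} (h : C ∈ E ∧ (C ∩ H).Nonempty) : depth E H C =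
    Order.height (⟨C, h⟩ : {C : Set G // C ∈ E ∧ (C ∩ H).Nonempty}) + 1 :=
  dif_pos h

theorem depth_of_not_nonempty {C : Set G} (h : ¬(C ∩ H).Nonempty) : depth E H C = 0 :=
  dif_neg fun h' => h h'.2

theorem depth_mono {C D : Set G} (hD : D ∈ E) (hCD : C ⊆ D) : depth E H C ≤ depth E H D := by
  by_cases hC : C ∈ E ∧ (C ∩ H).Nonempty
  · rw [depth_of_nonempty hC,
      depth_of_nonempty ⟨hD, hC.2.mono (Set.inter_subset_inter_left _ hCD)⟩]
    refine add_le_add_left (Order.height_mono ?_) 1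
    exact hCD
  · rw [depth, dif_neg hC]
    exact zero_le

theorem depth_lt_depth {C D : Set G} (hD : D ∈ E) (hCD : C ⊂ D)
    (hDH : (D ∩ H).Nonempty) (hfin : depth E H C < ⊤) : depth E H C < depth E H D := by
  rw [depth_of_nonempty ⟨hD, hDH⟩]
  by_cases hC : C ∈ E ∧ (C ∩ H).Nonempty
  · rw [depth_of_nonempty hC] at hfin ⊢
    have hfin' := lt_of_le_of_lt le_self_add hfin
    exact (ENat.add_lt_add_iff_right (by simp)).2
      (Order.height_strictMono (Subtype.mk_lt_mk.2 hCD) hfin')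
  · rw [depth, dif_neg hC]
    exact pos_of_ne_zero (by simp)

/-- All members of a chain below `C` separate a point of `H` in the smallest one from a point of `H`
outside `C`, so there are at most `N` of them. -/
theorem depth_le (hE : IsNestedFamily E) {N : ℕ}
    (hN : ∀ a ∈ H, ∀ b ∈ H, {C | C ∈ E ∧ a ∈ C ∧ b ∉ C}.ncard ≤ N) {C : Set G}
    (hC : (Cᶜ ∩ H).Nonempty) : depth E H C ≤ (N + 1 : ℕ) := by
  by_cases hCE : C ∈ E ∧ (C ∩ H).Nonempty
  · rw [depth_of_nonempty hCE]
    obtain ⟨b, hb, hbH⟩ := hC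
    rw [Nat.cast_add, Nat.cast_one]
    refine add_le_add_left (Order.height_le fun p hp => ?_) 1
    obtain ⟨a, ha, haH⟩ := p.head.2.2
    have hsub : (Subtype.val ∘ p) '' Set.univ ⊆ {C | C ∈ E ∧ a ∈ C ∧ b ∉ C} := by
      rintro _ ⟨i, -, rfl⟩
      refine ⟨(p i).2.1, p.head_le i ha, fun hbi => hb ?_⟩
      have hle : p i ≤ ⟨C, hCE⟩ := hp ▸ p.monotone (Fin.le_last i)
      exact hle hbi
    have hcard := Set.ncard_le_ncard hsub (hE.finite_separating a b)
    rw [Set.ncard_image_of_injective _ (Subtype.val_injective.comp p.strictMono.injective),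
      Set.ncard_univ, Nat.card_eq_fintype_card, Fintype.card_fin] at hcard
    have := hN a haH b hbH
    exact_mod_cast (by omega : p.length ≤ N)
  · rw [depth, dif_neg hCE]
    exact zero_le

theorem depth_smul_le (hE : IsNestedFamily E) {h : G} (hh : h ∈ H) (C : Set G) :
    depth E H C ≤ depth E H (h • C) := by
  have hP : ∀ C : Set G, C ∈ E ∧ (C ∩ H).Nonempty → h • C ∈ E ∧ (h • C ∩ H).Nonempty := by
    rintro C ⟨hC, x, hx, hxH⟩
    exact ⟨hE.stable h C hC, h * x, ⟨x, hx, rfl⟩, H.mul_mem hh hxH⟩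
  by_cases hC : C ∈ E ∧ (C ∩ H).Nonempty
  · rw [depth_of_nonempty hC, depth_of_nonempty (hP C hC)]
    refine add_le_add_left ?_ 1
    refine Order.height_le_height_apply_of_strictMono
      (fun D : {C : Set G // C ∈ E ∧ (C ∩ H).Nonempty} =>
        (⟨h • D.1, hP D.1 D.2⟩ : {C : Set G // C ∈ E ∧ (C ∩ H).Nonempty})) ?_ ⟨C, hC⟩
    intro D D' hlt
    exact (smul_ssubset_smul_iff h D.1 D'.1).2 hlt
  · rw [depth, dif_neg hC]
    exact zero_le

theorem depth_smul (hE : IsNestedFamily E) {h : G} (hh : h ∈ H) (C : Set G) :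
    depth E H (h • C) = depth E H C := by
  refine le_antisymm ?_ (depth_smul_le hE hh C)
  simpa using depth_smul_le hE (H.inv_mem hh) (h • C)

/-- The vertex of the elements of `E` which are deeper than their complements. -/
def center (E : Set (Set G)) (H : Subgroup G) : Set (Set G) :=
  {C | C ∈ E ∧ depth E H Cᶜ < depth E H C}

theorem smul_center (hE : IsNestedFamily E) {h : G} (hh : h ∈ H) :
    h • center E H = center E H := by
  ext C
  rw [Set.mem_smul_set_iff_inv_smul_mem]
  change (h⁻¹ • C ∈ E ∧ depth E H (h⁻¹ • C)ᶜ < depth E H (h⁻¹ • C)) ↔ _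
  rw [← Set.smul_set_compl, depth_smul hE (H.inv_mem hh), depth_smul hE (H.inv_mem hh),
    hE.smul_mem_iff]
  rfl

theorem depth_pos {C : Set G} (hC : C ∈ E) (hCH : (C ∩ H).Nonempty) : 0 < depth E H C := by
  rw [depth_of_nonempty ⟨hC, hCH⟩]
  exact pos_of_ne_zero (by simp)

theorem nonempty_inter_of_depth_eq (hE : IsNestedFamily E) {C : Set G} (hC : C ∈ E)
    (h : depth E H C = depth E H Cᶜ) : (C ∩ H).Nonempty := by
  by_contra hne
  have h1 : (1 : G) ∈ Cᶜ := fun hx => hne ⟨1, hx, H.one_mem⟩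
  have := depth_pos (hE.compl_mem C hC) ⟨1, h1, H.one_mem⟩
  rw [← h, depth_of_not_nonempty hne] at this
  exact this.ne rfl

/-- Passing from `C` to `D` strictly raises the depth, while passing from `Cᶜ` to `Dᶜ` cannot raise
it, so the two equalities conflict. -/
theorem not_ssubset_of_depth_eq (hE : IsNestedFamily E) {N : ℕ}
    (hN : ∀ a ∈ H, ∀ b ∈ H, {C | C ∈ E ∧ a ∈ C ∧ b ∉ C}.ncard ≤ N) {C D : Set G} (hC : C ∈ E)
    (hD : D ∈ E) (hC' : depth E H C = depth E H Cᶜ) (hD' : depth E H D = depth E H Dᶜ) :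
    ¬C ⊂ D := by
  intro hCD
  have hCc : (Cᶜ ∩ H).Nonempty :=
    nonempty_inter_of_depth_eq hE (hE.compl_mem C hC) (by rw [compl_compl, hC'])
  have h1 := depth_lt_depth hD hCD (nonempty_inter_of_depth_eq hE hD hD')
    ((depth_le hE hN hCc).trans_lt (ENat.natCast_lt_top _))
  have h2 : depth E H Dᶜ ≤ depth E H Cᶜ :=
    depth_mono (hE.compl_mem C hC) (Set.compl_subset_compl.2 hCD.subset)
  rw [hC', hD'] at h1
  exact h1.not_ge h2

theorem eq_or_eq_compl_of_depth_eq (hE : IsNestedFamily E) {N : ℕ}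
    (hN : ∀ a ∈ H, ∀ b ∈ H, {C | C ∈ E ∧ a ∈ C ∧ b ∉ C}.ncard ≤ N) {C D : Set G} (hC : C ∈ E)
    (hD : D ∈ E) (hC' : depth E H C = depth E H Cᶜ) (hD' : depth E H D = depth E H Dᶜ) :
    D = C ∨ D = Cᶜ := by
  have hCc := hE.compl_mem C hC
  have hCc' : depth E H Cᶜ = depth E H Cᶜᶜ := by rw [compl_compl, hC']
  have key : ∀ D ∈ E, depth E H D = depth E H Dᶜ → D ∉ midpoint E C := by
    rintro D hD hD' ⟨-, h | h⟩
    · exact not_ssubset_of_depth_eq hE hN hC hD hC' hD' h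
    · exact not_ssubset_of_depth_eq hE hN hCc hD hCc' hD' h
  exact ((mem_midpoint_or hE hC hD).resolve_left (key D hD hD')).resolve_left
    (key Dᶜ (hE.compl_mem D hD) (by rw [compl_compl, hD']))

/-- On this set the depth is at most `N + 1`, being bounded by that of the complement, and
nestedness makes it injective. -/
theorem finite_principal_diff_center (hE : IsNestedFamily E) {N : ℕ}
    (hN : ∀ a ∈ H, ∀ b ∈ H, {C | C ∈ E ∧ a ∈ C ∧ b ∉ C}.ncard ≤ N) :
    (principal E 1 \ center E H).Finite := by
  have hle : ∀ C ∈ principal E 1 \ center E H, depth E H C ≤ depth E H Cᶜ :=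
    fun C hC => not_lt.1 fun h => hC.2 ⟨hC.1.1, h⟩
  have hcompl : ∀ C ∈ principal E 1, depth E H Cᶜ ≤ (N + 1 : ℕ) := fun C hC =>
    depth_le hE hN (by rw [compl_compl]; exact ⟨1, hC.2, H.one_mem⟩)
  have hlt : ∀ C ∈ principal E 1 \ center E H, ∀ D ∈ principal E 1, C ⊂ D →
      depth E H C < depth E H D := fun C hC D hD hCD =>
    depth_lt_depth hD.1 hCD ⟨1, hD.2, H.one_mem⟩
      (((hle C hC).trans (hcompl C hC.1)).trans_lt (ENat.natCast_lt_top _))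
  refine Set.Finite.of_finite_image (f := depth E H) ?_ ?_
  · refine ((Set.finite_Iic (N + 1)).image (Nat.cast : ℕ → ℕ∞)).subset ?_
    rintro _ ⟨C, hC, rfl⟩
    have h := (hle C hC).trans (hcompl C hC.1)
    obtain ⟨n, hn⟩ := ENat.ne_top_iff_exists.1 (h.trans_lt (ENat.natCast_lt_top _)).ne
    rw [← hn] at h ⊢
    exact ⟨n, by exact_mod_cast h, rfl⟩
  · intro C hC D hD hCD
    by_contra hne
    rcases hE.nested C hC.1.1 D hD.1.1 with h | h | h | h
    · exact (hlt C hC D hD.1 (h.ssubset_of_ne hne)).ne hCD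
    · exact h hC.1.2 hD.1.2
    -- Here `Dᶜ` is strictly shallower than `C`, which is as deep as `D`, contradicting that `D` is
    -- not deeper than `Dᶜ`.
    · have hss : Dᶜ ⊂ C :=
        (Set.compl_subset_comm.1 h).ssubset_of_ne fun h' => (h' ▸ hC.1.2 : (1 : G) ∈ Dᶜ) hD.1.2
      have := depth_lt_depth hC.1.1 hss ⟨1, hC.1.2, H.one_mem⟩
        ((hcompl D hD.1).trans_lt (ENat.natCast_lt_top _))
      exact this.not_ge (hCD.trans_le (hle D hD))
    · exact (hlt D hD C hC.1 ((Set.compl_subset_compl.1 h).ssubset_of_ne (Ne.symm hne))).ne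
        hCD.symm

theorem isVertex_center (hE : IsNestedFamily E) {N : ℕ}
    (hN : ∀ a ∈ H, ∀ b ∈ H, {C | C ∈ E ∧ a ∈ C ∧ b ∉ C}.ncard ≤ N) :
    IsVertex E (center E H) where
  subset := fun _ hC => hC.1
  mem_of_subset := fun C hC D hD hCD => ⟨hD, lt_of_le_of_lt
    (depth_mono (hE.compl_mem C hC.1) (Set.compl_subset_compl.2 hCD))
    (hC.2.trans_le (depth_mono hD hCD))⟩
  compl_notMem := fun C hC hC' => by
    have := hC'.2
    rw [compl_compl] at this
    exact lt_asymm this hC.2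
  unique_gap := by
    have heq : ∀ C ∈ E, C ∉ center E H → Cᶜ ∉ center E H → depth E H C = depth E H Cᶜ :=
      fun C hC h h' => le_antisymm (not_lt.1 fun hlt => h ⟨hC, hlt⟩)
        (not_lt.1 fun hlt => h' ⟨hE.compl_mem C hC, by rwa [compl_compl]⟩)
    exact fun C hC D hD h1 h2 h3 h4 =>
      eq_or_eq_compl_of_depth_eq hE hN hC hD (heq C hC h1 h2) (heq D hD h3 h4)
  finite := by
    have hfin := finite_principal_diff_center hE hN
    refine ((hfin.image compl).union hfin).subset ?_
    rintro C (⟨⟨hC, hlt⟩, h1⟩ | h)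
    · refine Or.inl ⟨Cᶜ, ⟨⟨hE.compl_mem C hC, fun h => h1 ⟨hC, h⟩⟩, fun h => ?_⟩, compl_compl C⟩
      have := h.2
      rw [compl_compl] at this
      exact lt_asymm this hlt
    · exact Or.inr h

end Depth

/-- The subgroups fixing a vertex of the tree of a nested family `E` are the subgroups `H` for
which all elements of `E` are almost right `H`-sets. -/
theorem gSubstabs_nestedTree {G : Type u} [Group G] {E : Set (Set G)} (hE : IsNestedFamily E) :
    gSubstabs G (nestedTree hE).V = almostStabs E := by
  ext H
  constructor
  · rintro ⟨v, hv⟩ C hC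
    exact v.2.isAlmostRightSet hE (fun h hh => congrArg Subtype.val (hv h hh)) hC
  · intro hH
    obtain ⟨N, hN⟩ := hE.exists_ncard_separating_le hH
    exact ⟨⟨center E H, isVertex_center hE hN⟩, fun h hh => Subtype.ext (smul_center hE hh)⟩

end AlmostStability

theorem theorem6p1 {G : Type u} [Group G] (hG : Group.FG G)
    (F : Set (Set G)) (hFB : ∀ A ∈ F, A ∈ AlmostStability.boolAlg G)
    (hFstable : AlmostStability.IsGStable G F)
    (hFfinite : AlmostStability.IsGFinite G F) :
    ∃ T : AlmostStability.GGraph G,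
      T.IsTree ∧ T.GFinite ∧
      AlmostStability.gSubstabs G T.V = AlmostStability.almostStabs F ∧
      AlmostStability.IsGQuasifree G T.E := by
  obtain ⟨E, hE, hEF⟩ := AlmostStability.exists_isNestedFamily hG hFB hFstable hFfinite
  exact ⟨AlmostStability.nestedTree hE, AlmostStability.isTree_nestedTree hE,
    AlmostStability.gFinite_nestedTree hE,
    (AlmostStability.gSubstabs_nestedTree hE).trans
      (AlmostStability.almostStabs_eq_of_closure_eq hEF),
    AlmostStability.isGQuasifree_nestedTree hE⟩
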